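/- Let $0<s<1$, $1<p<\infty$ and $\alpha\in\mathbb{R}$ (no smallness of $\alpha$ is required), and consider the planar angular domains $$D=\{x\in\mathbb{R}^2: x_1>0,\ \alpha x_1<x_2\},\qquad D_-=\{x\in\mathbb{R}^2: x_1>0,\ x_2<\alpha x_1\},$$ and the half plane $H=\{x\in\mathbb{R}^2: x_1>0\}$. For an open set $\Omega\subset\mathbb{R}^2$ and a measurable field $u:\Omega\to\mathbb{R}^2$ put $$[u]_{\mathcal X^{s,p}(\Omega)}=\left(\int_\Omega\int_\Omega \frac{\left|(u(y)-u(x))\cdot\frac{y-x}{|y-x|}\right|^p}{|y-x|^{2+ps}}\,dy\,dx\right)^{1/p},\qquad \|u\|_{\mathcal X^{s,p}(\Omega)}=\|u\|_{L^p(\Omega)}+[u]_{\mathcal X^{s,p}(\Omega)},$$ and let $\mathcal X^{s,p}(\Omega)$ be the closure of $C^1_c(\overline\Omega;\mathbb{R}^2)$ (the restrictions to $\overline\Omega$ of compactly supported $C^1$ fields on $\mathbb{R}^2$) with respect to $\|\cdot\|_{\mathcal X^{s,p}(\Omega)}$, in the space of all $u\in L^p(\Omega;\mathbb{R}^2)$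 with $[u]_{\mathcal X^{s,p}(\Omega)}<\infty$. Then there exist a linear operator $E:\mathcal X^{s,p}(D)\to\mathcal X^{s,p}(H)$ and a constant $C>0$ depending only on $p$, $s$ and $\alpha$ such that, for all $u\in\mathcal X^{s,p}(D)$, $E(u)=u$ a.e. in $D$, the operator is bounded, $$\|E(u)\|_{\mathcal X^{s,p}(H)}\le C\,\|u\|_{\mathcal X^{s,p}(D)},$$ and $$[E(u)]_{\mathcal X^{s,p}(H)}\le C\left([u]_{\mathcal X^{s,p}(D)}+\|u\|_{L^p(D)}\right).$$ Moreover, $E$ is a modified Nitsche extension: there is $\delta\in(0,\tfrac12]$ such that, with $\lambda=1-\delta$, $\mu=1+\delta$, $k=\frac{1+\mu}{\mu-\lambda}$, $\ell=-\frac{1+\lambda}{\mu-\lambda}$, $m=-\lambda k$, $q=-\mu\ell$ and $u_i^{\eta}(x)=u_i\big(x_1,\ \alpha x_1+\eta(\alpha x_1-x_2)\big)$, for every $u\in\mathcal X^{s,p}(D)$ and a.e. $x\in D_-$, $$E(u)(x)=\Big(k\,u_1^\lambda+\ell\,u_1^\mu+\alpha k(1+\lambda)\,(u_2^\lambda-u_2^\mu),\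 \ m\,u_2^\lambda+q\,u_2^\mu\Big)(x).$$ -/

import Mathlib

open MeasureTheory Filter Topology
open scoped ENNReal

namespace FracKorn

/-- The projected difference of the vector field `u` along the bond `y - x`:
`(u(y) - u(x)) · (y - x) / |y - x|` (its value for `x = y` plays no role). -/
noncomputable def projDiff {n : ℕ} (u : EuclideanSpace ℝ (Fin n) → EuclideanSpace ℝ (Fin n))
    (x y : EuclideanSpace ℝ (Fin n)) : ℝ :=
  inner ℝ (u y - u x) (‖y - x‖⁻¹ • (y - x))

/-- The `p`-th power of the seminorm,
`∫_Ω ∫_Ω |(u(y) - u(x)) · (y - x)/|y - x||^p / |y - x|^(n + ps) dy dx`, with values in `[0, ∞]`. -/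
noncomputable def energy {n : ℕ} (s p : ℝ) (Ω : Set (EuclideanSpace ℝ (Fin n)))
    (u : EuclideanSpace ℝ (Fin n) → EuclideanSpace ℝ (Fin n)) : ℝ≥0∞ :=
  ∫⁻ x in Ω, ∫⁻ y in Ω, ENNReal.ofReal (|projDiff u x y| ^ p / ‖y - x‖ ^ ((n : ℝ) + p * s))

/-- The seminorm `[u]_{X^{s,p}(Ω)}`, with values in `[0, ∞]`. -/
noncomputable def seminormX {n : ℕ} (s p : ℝ) (Ω : Set (EuclideanSpace ℝ (Fin n)))
    (u : EuclideanSpace ℝ (Fin n) → EuclideanSpace ℝ (Fin n)) : ℝ≥0∞ :=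
  energy s p Ω u ^ (1 / p)

/-- The norm `‖u‖_{X^{s,p}(Ω)} = ‖u‖_{L^p(Ω)} + [u]_{X^{s,p}(Ω)}`, with values in `[0, ∞]`. -/
noncomputable def normX {n : ℕ} (s p : ℝ) (Ω : Set (EuclideanSpace ℝ (Fin n)))
    (u : EuclideanSpace ℝ (Fin n) → EuclideanSpace ℝ (Fin n)) : ℝ≥0∞ :=
  eLpNorm u (ENNReal.ofReal p) (volume.restrict Ω) + seminormX s p Ω u

/-- Compactly supported `C¹` fields on `ℝⁿ`; their restrictions to the closure of `Ω` form
`C¹_c(closure Ω; ℝⁿ)`. -/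
def IsC1c {n : ℕ} (φ : EuclideanSpace ℝ (Fin n) → EuclideanSpace ℝ (Fin n)) : Prop :=
  ContDiff ℝ 1 φ ∧ HasCompactSupport φ

section Helpers

variable {n : ℕ} {s p : ℝ} {Ω : Set (EuclideanSpace ℝ (Fin n))}
  {u v : EuclideanSpace ℝ (Fin n) → EuclideanSpace ℝ (Fin n)}

/-- The weighted projected difference quotient, as a function on `ℝⁿ × ℝⁿ`. -/
noncomputable def quot (s p : ℝ) (u : EuclideanSpace ℝ (Fin n) → EuclideanSpace ℝ (Fin n))
    (z : EuclideanSpace ℝ (Fin n) × EuclideanSpace ℝ (Fin n)) : ℝ :=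
  projDiff u z.1 z.2 / ‖z.2 - z.1‖ ^ ((n : ℝ) / p + s)

theorem quot_add : quot s p (u + v) = quot s p u + quot s p v := by
  funext z
  simp only [quot, projDiff, Pi.add_apply, ← add_div, ← inner_add_left]
  congr 2
  abel

theorem quot_smul (c : ℝ) : quot s p (c • u) = c • quot s p u := by
  funext z
  simp only [quot, projDiff, Pi.smul_apply, ← smul_sub, real_inner_smul_left, smul_eq_mul]
  ring

theorem aestronglyMeasurable_quot
    (hu : AEStronglyMeasurable u (volume.restrict Ω)) :
    AEStronglyMeasurable (quot s p u) ((volume.restrict Ω).prod (volume.restrict Ω)) := by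
  have h1 : AEStronglyMeasurable (fun z : EuclideanSpace ℝ (Fin n) × EuclideanSpace ℝ (Fin n) =>
      u z.2 - u z.1) ((volume.restrict Ω).prod (volume.restrict Ω)) := hu.comp_snd.sub hu.comp_fst
  have h2 : Measurable (fun z : EuclideanSpace ℝ (Fin n) × EuclideanSpace ℝ (Fin n) =>
      ‖z.2 - z.1‖⁻¹ • (z.2 - z.1)) := by fun_prop
  have h3 : Measurable (fun z : EuclideanSpace ℝ (Fin n) × EuclideanSpace ℝ (Fin n) =>
      ‖z.2 - z.1‖ ^ ((n : ℝ) / p + s)) := by fun_prop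
  have h4 := (h1.inner (𝕜 := ℝ) h2.aestronglyMeasurable).aemeasurable.div h3.aemeasurable
  exact h4.aestronglyMeasurable

theorem seminormX_eq (hp : 0 < p) (hu : AEStronglyMeasurable u (volume.restrict Ω)) :
    seminormX s p Ω u =
      eLpNorm (quot s p u) (ENNReal.ofReal p) ((volume.restrict Ω).prod (volume.restrict Ω)) := by
  have hp0 : ENNReal.ofReal p ≠ 0 := by simpa using hp
  rw [eLpNorm_eq_lintegral_rpow_enorm_toReal hp0 ENNReal.ofReal_ne_top, ENNReal.toReal_ofReal hp.le,
    lintegral_prod _ ((aestronglyMeasurable_quot hu).enorm.pow_const p)]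
  unfold seminormX energy
  congr 1
  refine lintegral_congr fun x => lintegral_congr fun y => ?_
  rw [Real.enorm_eq_ofReal_abs, ENNReal.ofReal_rpow_of_nonneg (abs_nonneg _) hp.le]
  congr 1
  simp only [quot]
  rw [abs_div, Real.div_rpow (abs_nonneg _) (abs_nonneg _),
    abs_of_nonneg (Real.rpow_nonneg (norm_nonneg (y - x)) _), ← Real.rpow_mul (norm_nonneg _)]
  congr 2
  field_simp

theorem seminormX_congr (h : u =ᵐ[volume.restrict Ω] v) :
    seminormX s p Ω u = seminormX s p Ω v := by
  unfold seminormX energy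
  congr 1
  refine lintegral_congr_ae ?_
  filter_upwards [h] with x hx
  refine lintegral_congr_ae ?_
  filter_upwards [h] with y hy
  simp only [projDiff, hx, hy]

theorem normX_congr (h : u =ᵐ[volume.restrict Ω] v) : normX s p Ω u = normX s p Ω v := by
  unfold normX
  rw [seminormX_congr h, eLpNorm_congr_ae h]

theorem seminormX_add_le (hp : 1 < p) (hu : AEStronglyMeasurable u (volume.restrict Ω))
    (hv : AEStronglyMeasurable v (volume.restrict Ω)) :
    seminormX s p Ω (u + v) ≤ seminormX s p Ω u + seminormX s p Ω v := by
  have h0 : 0 < p := by linarith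
  rw [seminormX_eq h0 hu, seminormX_eq h0 hv, seminormX_eq h0 (hu.add hv), quot_add]
  exact eLpNorm_add_le (aestronglyMeasurable_quot hu) (aestronglyMeasurable_quot hv)
    (by simpa using hp.le)

theorem seminormX_smul (hp : 1 < p) (c : ℝ) (hu : AEStronglyMeasurable u (volume.restrict Ω)) :
    seminormX s p Ω (c • u) = ‖c‖ₑ * seminormX s p Ω u := by
  have h0 : 0 < p := by linarith
  rw [seminormX_eq h0 hu, seminormX_eq h0 (hu.const_smul c), quot_smul, eLpNorm_const_smul]

theorem normX_add_le (hp : 1 < p) (hu : AEStronglyMeasurable u (volume.restrict Ω))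
    (hv : AEStronglyMeasurable v (volume.restrict Ω)) :
    normX s p Ω (u + v) ≤ normX s p Ω u + normX s p Ω v := by
  unfold normX
  calc _ ≤ (eLpNorm u (ENNReal.ofReal p) (volume.restrict Ω) +
        eLpNorm v (ENNReal.ofReal p) (volume.restrict Ω)) +
        (seminormX s p Ω u + seminormX s p Ω v) :=
        add_le_add (eLpNorm_add_le hu hv (by simpa using hp.le)) (seminormX_add_le hp hu hv)
    _ = _ := by ring

theorem normX_smul (hp : 1 < p) (c : ℝ) (hu : AEStronglyMeasurable u (volume.restrict Ω)) :
    normX s p Ω (c • u) = ‖c‖ₑ * normX s p Ω u := by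
  unfold normX
  rw [seminormX_smul hp c hu, eLpNorm_const_smul, mul_add]

theorem seminormX_zero (hp : 1 < p) : seminormX s p Ω 0 = 0 := by
  have h := seminormX_smul (s := s) (Ω := Ω) hp 0 (u := 0) aestronglyMeasurable_zero
  simpa using h

theorem normX_zero (hp : 1 < p) : normX s p Ω 0 = 0 := by
  simp [normX, seminormX_zero hp]

theorem IsC1c.aesm {φ : EuclideanSpace ℝ (Fin n) → EuclideanSpace ℝ (Fin n)} (h : IsC1c φ) :
    AEStronglyMeasurable φ (volume.restrict Ω) :=
  h.1.continuous.aestronglyMeasurable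

end Helpers

/-- The space `X^{s,p}(Ω)`: the closure of `C¹_c(closure Ω; ℝⁿ)` with respect to the norm
`‖·‖_{X^{s,p}(Ω)}`, inside the space of all `u ∈ L^p(Ω; ℝⁿ)` with finite seminorm. Its elements
are classes of fields on `Ω` modulo equality almost everywhere on `Ω`. -/
noncomputable def XSpace {n : ℕ} (s p : ℝ) (hp : 1 < p) (Ω : Set (EuclideanSpace ℝ (Fin n))) :
    Submodule ℝ (Lp (EuclideanSpace ℝ (Fin n)) (ENNReal.ofReal p) (volume.restrict Ω)) where
  carrier := {u | seminormX s p Ω u < ∞ ∧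
    ∃ φ : ℕ → EuclideanSpace ℝ (Fin n) → EuclideanSpace ℝ (Fin n), (∀ k, IsC1c (φ k)) ∧
      Tendsto (fun k => normX s p Ω (fun x => u x - φ k x)) atTop (𝓝 0)}
  zero_mem' := by
    have h0 : ((0 : Lp (EuclideanSpace ℝ (Fin n)) (ENNReal.ofReal p) (volume.restrict Ω)) :
        EuclideanSpace ℝ (Fin n) → EuclideanSpace ℝ (Fin n)) =ᵐ[volume.restrict Ω] 0 :=
      Lp.coeFn_zero _ _ _
    refine ⟨?_, fun _ => 0, fun _ => ⟨contDiff_const, HasCompactSupport.zero⟩, ?_⟩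
    · rw [seminormX_congr h0, seminormX_zero hp]
      exact ENNReal.zero_lt_top
    · simp only [Pi.zero_apply, sub_zero]
      rw [normX_congr h0, normX_zero hp]
      exact tendsto_const_nhds
  add_mem' := by
    rintro u v ⟨hu, φ, hφ, hφu⟩ ⟨hv, ψ, hψ, hψv⟩
    have hum := Lp.aestronglyMeasurable u
    have hvm := Lp.aestronglyMeasurable v
    refine ⟨?_, fun k => φ k + ψ k,
      fun k => ⟨(hφ k).1.add (hψ k).1, (hφ k).2.add (hψ k).2⟩, ?_⟩
    · rw [seminormX_congr (Lp.coeFn_add u v)]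
      exact (seminormX_add_le hp hum hvm).trans_lt (ENNReal.add_lt_top.2 ⟨hu, hv⟩)
    · have hs := hφu.add hψv
      rw [add_zero] at hs
      refine tendsto_of_tendsto_of_tendsto_of_le_of_le tendsto_const_nhds hs
        (fun _ => zero_le) fun k => ?_
      refine le_trans (le_of_eq (normX_congr ?_))
        (normX_add_le hp (hum.sub (hφ k).aesm) (hvm.sub (hψ k).aesm))
      filter_upwards [Lp.coeFn_add u v] with x hx
      simp only [hx, Pi.add_apply]
      abel
  smul_mem' := by
    rintro c u ⟨hu, φ, hφ, hφu⟩
    have hum := Lp.aestronglyMeasurable u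
    refine ⟨?_, fun k => c • φ k,
      fun k => ⟨(hφ k).1.const_smul c, (hφ k).2.smul_left (f := fun _ => c)⟩, ?_⟩
    · rw [seminormX_congr (Lp.coeFn_smul c u), seminormX_smul hp c hum]
      exact ENNReal.mul_lt_top enorm_lt_top hu
    · have hs := ENNReal.Tendsto.const_mul (a := ‖c‖ₑ) hφu (Or.inr enorm_ne_top)
      rw [mul_zero] at hs
      refine hs.congr fun k => ?_
      refine (normX_smul hp c (hum.sub (hφ k).aesm)).symm.trans (normX_congr ?_)
      filter_upwards [Lp.coeFn_smul c u] with x hx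
      simp only [hx, Pi.smul_apply, Pi.sub_apply, smul_sub]

/-- The angular domain `{x₁ > 0, α x₁ < x₂}`. Coordinates are numbered from `0`. -/
def angle (α : ℝ) : Set (EuclideanSpace ℝ (Fin 2)) := {x | 0 < x 0 ∧ α * x 0 < x 1}

/-- The complementary angular domain `{x₁ > 0, x₂ < α x₁}`. -/
def angleLower (α : ℝ) : Set (EuclideanSpace ℝ (Fin 2)) := {x | 0 < x 0 ∧ x 1 < α * x 0}

/-- The half plane `{x₁ > 0}`. -/
def halfPlane : Set (EuclideanSpace ℝ (Fin 2)) := {x | 0 < x 0}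

/-- The skew reflection `Φ_η(x) = (x₁, αx₁ + η(αx₁ - x₂))` of the lower angle onto the upper. -/
noncomputable def reflection (α η : ℝ) (x : EuclideanSpace ℝ (Fin 2)) : EuclideanSpace ℝ (Fin 2) :=
  !₂[x 0, α * x 0 + η * (α * x 0 - x 1)]

/-- The modified Nitsche extension formula in the lower angle, for parameters `0 < lam < mu`,
where `k = (1+mu)/(mu-lam)`, `l = -(1+lam)/(mu-lam)`, `m = -lam k`, `q = -mu l`. -/
noncomputable def nitsche (α lam mu : ℝ)
    (u : EuclideanSpace ℝ (Fin 2) → EuclideanSpace ℝ (Fin 2))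
    (x : EuclideanSpace ℝ (Fin 2)) : EuclideanSpace ℝ (Fin 2) :=
  let k := (1 + mu) / (mu - lam)
  let l := -(1 + lam) / (mu - lam)
  let m := -(lam * (1 + mu)) / (mu - lam)
  let q := mu * (1 + lam) / (mu - lam)
  let ulam := u (reflection α lam x)
  let umu := u (reflection α mu x)
  !₂[k * ulam 0 + l * umu 0 + α * k * (1 + lam) * (ulam 1 - umu 1), m * ulam 1 + q * umu 1]

end FracKorn

/-! Call (u(y) - u(x)) · (y - x) a bond; the energy integrates its p-th power against a power of |y
- x|. Let Φ_η be the skew reflection, a linear map fixing the line between the two angles. The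
extension is k Φ_λᵀ(u∘Φ_λ) + ℓ Φ_μᵀ(u∘Φ_μ), and k + ℓ = 1, kλ + ℓμ = -1, so that x = kΦ_λ(x) +
ℓΦ_μ(x). The choice δ = 1/2 gives λ = 1/2, μ = 3/2, k = 5/2, ℓ = -3/2.

Inside the lower angle the transposes turn each bond of the extension exactly into k and ℓ times
bonds of u between reflected points (`bond_lowerExt`), and a linear change of variables finishes.
For x below and y above the line, `inner_lowerExt_sub` gives bonds from y to a = Φ_λ(x) and b =
Φ_μ(x), plus one error: the bond of a and b, multiplied by the height of y over the depth t of x.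
Integrating the error in y leaves a Hardy-type integral of |bond u a b|^p / t^(ps+p) over x
(`exists_lintegral_bond_reflection_le`).

The pairs (a, b) form a null set of D × D, so the energy does not see them directly, and projected
differences obey no triangle inequality, since a detour changes the direction of projection.
However, the six bonds among four points of the plane are linearly dependent: there are eight
displacement components and three infinitesimal rigid motions. If the fourth point w is the centroid
of a, b, z, the relation has constant coefficients (`bond_centroid`). It expresses the bond of a and
b through five bonds, each joining a pair that depends linearly and invertibly on (x, z). Averaging
over z in a ball of radius t inside D gives the bound for every α, and with the seminorm alone on
the right.

It remains to stay in the closure of C¹ fields. The extension of a C¹ field is merely Lipschitz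
across the line, but mollifications of a compactly supported Lipschitz field converge in the norm
because s < 1 (`exists_isC1c_normX_sub_le`). -/

namespace FracKorn

/-! ### Bonds and the energy. -/

/-- The Euclidean plane. -/
abbrev Plane : Type := EuclideanSpace ℝ (Fin 2)

/-- The unnormalised projected difference `(u(y) - u(x)) · (y - x)`. -/
noncomputable def bond (u : Plane → Plane) (x y : Plane) : ℝ := inner ℝ (u y - u x) (y - x)

/-- The integrand of the energy in the plane, in terms of `bond`. -/
noncomputable def bondKernel (s p : ℝ) (u : Plane → Plane) (x y : Plane) : ℝ≥0∞ :=
  ENNReal.ofReal (|bond u x y| ^ p / ‖y - x‖ ^ (2 + p * s + p))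

theorem bond_eq (u : Plane → Plane) (x y : Plane) :
    bond u x y = (u y 0 - u x 0) * (y 0 - x 0) + (u y 1 - u x 1) * (y 1 - x 1) := by
  simp [bond, PiLp.inner_apply, Fin.sum_univ_two]
  ring

theorem bond_comm (u : Plane → Plane) (x y : Plane) : bond u x y = bond u y x := by
  rw [bond_eq, bond_eq]; ring

theorem bond_self (u : Plane → Plane) (x : Plane) : bond u x x = 0 := by simp [bond]

theorem bondKernel_comm (s p : ℝ) (u : Plane → Plane) (x y : Plane) :
    bondKernel s p u x y = bondKernel s p u y x := by
  rw [bondKernel, bondKernel, bond_comm, norm_sub_rev]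

theorem bondKernel_self {s p : ℝ} (hp : 0 < p) (u : Plane → Plane) (x : Plane) :
    bondKernel s p u x x = 0 := by
  simp [bondKernel, bond_self, Real.zero_rpow hp.ne']

/-- Normalising the direction costs one factor of length, hence the additional `p` in the exponent
of `bondKernel`. On the diagonal both numerators are `0 ^ p = 0`. -/
theorem ofReal_projDiff_eq {s p : ℝ} (hp : 0 < p) (u : Plane → Plane) (x y : Plane) :
    ENNReal.ofReal (|projDiff u x y| ^ p / ‖y - x‖ ^ (((2 : ℕ) : ℝ) + p * s)) =
      bondKernel s p u x y := by
  rcases eq_or_ne x y with rfl | hxy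
  · rw [bondKernel_self hp]; simp [projDiff, Real.zero_rpow hp.ne']
  have h0 : 0 < ‖y - x‖ := norm_pos_iff.2 (sub_ne_zero.2 hxy.symm)
  rw [bondKernel, projDiff, inner_smul_right, ← bond, abs_mul, abs_of_pos (inv_pos.2 h0),
    Real.mul_rpow (inv_pos.2 h0).le (abs_nonneg _), Real.inv_rpow h0.le, Real.rpow_add h0 _ p]
  congr 1
  have h1 := Real.rpow_pos_of_pos h0 p
  have h2 := Real.rpow_pos_of_pos h0 (2 + p * s)
  push_cast
  field_simp

theorem energy_eq {s p : ℝ} (hp : 0 < p) (Ω : Set Plane) (u : Plane → Plane) :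
    energy s p Ω u = ∫⁻ x in Ω, ∫⁻ y in Ω, bondKernel s p u x y := by
  simp only [energy, ofReal_projDiff_eq hp]

theorem measurable_bondKernel_comp {β : Type*} [MeasurableSpace β] {s p : ℝ} {u : Plane → Plane}
    (hu : Measurable u) {f g : β → Plane} (hf : Measurable f) (hg : Measurable g) :
    Measurable fun z => bondKernel s p u (f z) (g z) := by
  unfold bondKernel bond
  have h1 : Measurable fun z => u (g z) - u (f z) := (hu.comp hg).sub (hu.comp hf)
  have h2 : Measurable fun z => g z - f z := hg.sub hf
  have h3 : Measurable fun z => (inner ℝ (u (g z) - u (f z)) (g z - f z) : ℝ) := h1.inner h2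
  have h4 : Measurable fun z => ‖g z - f z‖ ^ (2 + p * s + p) := h2.norm.pow_const _
  have h5 : Measurable fun z => |(inner ℝ (u (g z) - u (f z)) (g z - f z) : ℝ)| ^ p :=
    (measurable_norm.comp h3).pow_const p
  exact (h5.div h4).ennreal_ofReal

/-- Comparison of the energy density with the same bond weighted by a larger length. -/
theorem ofReal_bond_div_le {p q ρ M : ℝ} (hp : 0 < p) (hq : 0 < q) (hρ : 0 < ρ)
    (u : Plane → Plane) (a b : Plane) (h : ‖b - a‖ ≤ M * ρ) :
    ENNReal.ofReal (|bond u a b| ^ p / ρ ^ q) ≤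
      ENNReal.ofReal (M ^ q) * ENNReal.ofReal (|bond u a b| ^ p / ‖b - a‖ ^ q) := by
  rcases eq_or_ne a b with rfl | hab
  · simp [bond_self, Real.zero_rpow hp.ne']
  have h0 : 0 < ‖b - a‖ := norm_pos_iff.2 (sub_ne_zero.2 hab.symm)
  have hM : 0 < M := by
    by_contra hM
    nlinarith
  rw [← ENNReal.ofReal_mul (by positivity)]
  refine ENNReal.ofReal_le_ofReal ?_
  have h1 : ‖b - a‖ ^ q ≤ M ^ q * ρ ^ q := by
    rw [← Real.mul_rpow hM.le hρ.le]
    exact Real.rpow_le_rpow h0.le h hq.le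
  have h2 : 0 < ρ ^ q := Real.rpow_pos_of_pos hρ q
  have h3 : 0 < ‖b - a‖ ^ q := Real.rpow_pos_of_pos h0 q
  have h4 : 0 ≤ |bond u a b| ^ p := by positivity
  rw [mul_div_assoc', div_le_div_iff₀ h2 h3]
  nlinarith

/-- The power-mean inequality, with a common weight in the denominator. -/
theorem ofReal_rpow_div_le_sum {p q ρ c n : ℝ} (hp : 1 ≤ p) (hρ : 0 ≤ ρ) (hc : 0 ≤ c) {m : ℕ}
    (f : Fin m → ℝ) (h : |n| ≤ c * ∑ i, |f i|) :
    ENNReal.ofReal (|n| ^ p / ρ ^ q) ≤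
      ENNReal.ofReal (c ^ p * (m : ℝ) ^ (p - 1)) * ∑ i, ENNReal.ofReal (|f i| ^ p / ρ ^ q) := by
  have hρq : 0 ≤ ρ ^ q := Real.rpow_nonneg hρ q
  rw [← ENNReal.ofReal_sum_of_nonneg (fun i _ => by positivity),
    ← ENNReal.ofReal_mul (by positivity)]
  refine ENNReal.ofReal_le_ofReal ?_
  rw [← Finset.sum_div, mul_div_assoc']
  gcongr
  calc |n| ^ p ≤ (c * ∑ i, |f i|) ^ p := Real.rpow_le_rpow (abs_nonneg _) h (by linarith)
    _ = c ^ p * (∑ i, |f i|) ^ p :=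
        Real.mul_rpow hc (Finset.sum_nonneg fun i _ => abs_nonneg _)
    _ ≤ c ^ p * ((m : ℝ) ^ (p - 1) * ∑ i, |f i| ^ p) := by
        gcongr
        simpa using Real.rpow_sum_le_const_mul_sum_rpow Finset.univ f hp
    _ = _ := by ring

/-- Affine change of variables, as an inequality between integrals over sets. -/
theorem exists_setLIntegral_comp_affine_le (A : Plane ≃ₗ[ℝ] Plane) :
    ∃ C : ℝ≥0∞, C ≠ ∞ ∧ ∀ (f : Plane → ℝ≥0∞) (c : Plane) (S T : Set Plane), MeasurableSet S →
      MeasurableSet T → (∀ x ∈ S, A x + c ∈ T) →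
      ∫⁻ x in S, f (A x + c) ≤ C * ∫⁻ x in T, f x := by
  refine ⟨ENNReal.ofReal |(LinearMap.det (A : Plane →ₗ[ℝ] Plane))⁻¹|, ENNReal.ofReal_ne_top,
    fun f c S T hS hT h => ?_⟩
  have hdet : LinearMap.det (A : Plane →ₗ[ℝ] Plane) ≠ 0 := A.isUnit_det'.ne_zero
  have hmap := Measure.map_linearMap_addHaar_eq_smul_addHaar (volume : Measure Plane) hdet
  -- The change of variables passes through a measurable equivalence, so that `f` need not be
  -- measurable.
  let e : Plane ≃ᵐ Plane := A.toContinuousLinearEquiv.toHomeomorph.toMeasurableEquiv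
  have key (g : Plane → ℝ≥0∞) : ∫⁻ x, g (A x) =
      ENNReal.ofReal |(LinearMap.det (A : Plane →ₗ[ℝ] Plane))⁻¹| * ∫⁻ x, g x := by
    rw [← smul_eq_mul, ← lintegral_smul_measure, ← hmap]
    exact (lintegral_map_equiv g e).symm
  calc ∫⁻ x in S, f (A x + c) ≤ ∫⁻ x in S, T.indicator f (A x + c) :=
        setLIntegral_mono' hS fun x hx => by rw [Set.indicator_of_mem (h x hx)]
    _ ≤ ∫⁻ x, T.indicator f (A x + c) := setLIntegral_le_lintegral _ _
    _ = _ := by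
        rw [key fun x => T.indicator f (x + c), lintegral_add_right_eq_self,
          lintegral_indicator hT]

theorem abs_apply_le_norm (v : Plane) (i : Fin 2) : |v i| ≤ ‖v‖ := by
  simpa using PiLp.norm_apply_le v i

theorem norm_le_abs_add_abs (v : Plane) : ‖v‖ ≤ |v 0| + |v 1| := by
  rw [EuclideanSpace.norm_eq, Fin.sum_univ_two]
  refine Real.sqrt_le_iff.2 ⟨by positivity, ?_⟩
  simp only [Real.norm_eq_abs]
  nlinarith [abs_nonneg (v 0), abs_nonneg (v 1)]

/-! ### The skew reflections. -/

theorem reflection_apply_zero (α η : ℝ) (x : Plane) : reflection α η x 0 = x 0 := by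
  simp [reflection]

theorem reflection_apply_one (α η : ℝ) (x : Plane) :
    reflection α η x 1 = α * x 0 + η * (α * x 0 - x 1) := by
  simp [reflection]

/-- The skew reflection as a linear automorphism of the plane. -/
noncomputable def reflectionEquiv (α η : ℝ) (hη : η ≠ 0) : Plane ≃ₗ[ℝ] Plane where
  toFun := reflection α η
  invFun := reflection α η⁻¹
  map_add' x y := by
    ext i; fin_cases i <;> simp [reflection]
    ring
  map_smul' c x := by
    ext i; fin_cases i <;> simp [reflection]
    ring
  left_inv x := by
    ext i; fin_cases i <;> simp [reflection, hη]
  right_inv x := by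
    ext i; fin_cases i <;> simp [reflection, hη]

theorem reflectionEquiv_apply (α η : ℝ) (hη : η ≠ 0) (x : Plane) :
    reflectionEquiv α η hη x = reflection α η x := rfl

theorem continuous_reflection (α η : ℝ) : Continuous (reflection α η) := by
  unfold reflection
  fun_prop

theorem measurable_reflection (α η : ℝ) : Measurable (reflection α η) :=
  (continuous_reflection α η).measurable

theorem measurableSet_angle (α : ℝ) : MeasurableSet (angle α) := by
  have h0 : IsOpen {x : Plane | 0 < x 0} := isOpen_lt (by fun_prop) (by fun_prop)
  have h1 : IsOpen {x : Plane | α * x 0 < x 1} := isOpen_lt (by fun_prop) (by fun_prop)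
  exact (h0.and h1).measurableSet

theorem measurableSet_angleLower (α : ℝ) : MeasurableSet (angleLower α) := by
  have h0 : IsOpen {x : Plane | 0 < x 0} := isOpen_lt (by fun_prop) (by fun_prop)
  have h1 : IsOpen {x : Plane | x 1 < α * x 0} := isOpen_lt (by fun_prop) (by fun_prop)
  exact (h0.and h1).measurableSet

theorem reflection_mem_angle {α η : ℝ} (hη : 0 < η) {x : Plane} (hx : x ∈ angleLower α) :
    reflection α η x ∈ angle α := by
  refine ⟨by rw [reflection_apply_zero]; exact hx.1, ?_⟩
  rw [reflection_apply_zero, reflection_apply_one]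
  have := mul_pos hη (sub_pos.2 hx.2)
  linarith

theorem norm_reflection_sub_le {α η : ℝ} (hη : 0 ≤ η) (x y : Plane) :
    ‖reflection α η y - reflection α η x‖ ≤ (1 + |α| + η * (1 + |α|)) * ‖y - x‖ := by
  refine (norm_le_abs_add_abs _).trans ?_
  have h0 := abs_apply_le_norm (y - x) 0
  have h1 := abs_apply_le_norm (y - x) 1
  simp only [PiLp.sub_apply] at h0 h1
  simp only [PiLp.sub_apply, reflection_apply_zero, reflection_apply_one]
  have h2 : |α * (y 0 - x 0)| ≤ |α| * ‖y - x‖ := by rw [abs_mul]; gcongr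
  have h3 : |α * (y 0 - x 0) - (y 1 - x 1)| ≤ |α| * ‖y - x‖ + ‖y - x‖ :=
    (abs_sub _ _).trans (by linarith)
  have h4 : |η * (α * (y 0 - x 0) - (y 1 - x 1))| ≤ η * (|α| * ‖y - x‖ + ‖y - x‖) := by
    rw [abs_mul, abs_of_nonneg hη]; gcongr
  have h5 : α * y 0 + η * (α * y 0 - y 1) - (α * x 0 + η * (α * x 0 - x 1)) =
    α * (y 0 - x 0) + η * (α * (y 0 - x 0) - (y 1 - x 1)) := by ring
  rw [h5]
  have h6 := abs_add_le (α * (y 0 - x 0)) (η * (α * (y 0 - x 0) - (y 1 - x 1)))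
  nlinarith

/-! ### The extension formula and its bond identities. -/

/-- The modified Nitsche formula for `δ = 1/2`. -/
noncomputable def lowerExt (α : ℝ) (u : Plane → Plane) : Plane → Plane :=
  nitsche α (1 - 1 / 2) (1 + 1 / 2) u

theorem lowerExt_apply (α : ℝ) (u : Plane → Plane) (x : Plane) :
    lowerExt α u x =
      !₂[5 / 2 * u (reflection α (1 / 2) x) 0 - 3 / 2 * u (reflection α (3 / 2) x) 0 +
          15 / 4 * α * (u (reflection α (1 / 2) x) 1 - u (reflection α (3 / 2) x) 1),
        -(5 / 4) * u (reflection α (1 / 2) x) 1 + 9 / 4 * u (reflection α (3 / 2) x) 1] := by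
  have h1 : (1 : ℝ) - 1 / 2 = 1 / 2 := by norm_num
  have h2 : (1 : ℝ) + 1 / 2 = 3 / 2 := by norm_num
  simp only [lowerExt, nitsche, h1, h2]
  ext i
  fin_cases i <;> simp <;> ring

theorem lowerExt_apply_zero (α : ℝ) (u : Plane → Plane) (x : Plane) :
    lowerExt α u x 0 =
      5 / 2 * u (reflection α (1 / 2) x) 0 - 3 / 2 * u (reflection α (3 / 2) x) 0 +
          15 / 4 * α * (u (reflection α (1 / 2) x) 1 - u (reflection α (3 / 2) x) 1) := by
  simp [lowerExt_apply]

theorem lowerExt_apply_one (α : ℝ) (u : Plane → Plane) (x : Plane) :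
    lowerExt α u x 1 =
      -(5 / 4) * u (reflection α (1 / 2) x) 1 + 9 / 4 * u (reflection α (3 / 2) x) 1 := by
  simp [lowerExt_apply]

/-- Each part of the extension is the transpose of a reflection applied to `u` at the reflected
point. Moving the transpose across the inner product replaces `y - x` by the difference of the
reflected points. The mixed coefficient 15/4 α = α k(1+λ) arises from both transposes, since ℓ(1+μ)
= -k(1+λ). -/
theorem bond_lowerExt (α : ℝ) (u : Plane → Plane) (x y : Plane) :
    bond (lowerExt α u) x y =
      5 / 2 * bond u (reflection α (1 / 2) x) (reflection α (1 / 2) y) -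
        3 / 2 * bond u (reflection α (3 / 2) x) (reflection α (3 / 2) y) := by
  simp only [bond_eq, lowerExt_apply_zero, lowerExt_apply_one, reflection_apply_zero,
    reflection_apply_one]
  ring

/-- The bond between the extension at a lower point `x` and the field at `y`. -/
theorem inner_lowerExt_sub (α : ℝ) (u : Plane → Plane) (x y : Plane) (h : α * x 0 - x 1 ≠ 0) :
    inner ℝ (u y - lowerExt α u x) (y - x) =
      5 / 2 * bond u (reflection α (1 / 2) x) y - 3 / 2 * bond u (reflection α (3 / 2) x) y -
        15 / 4 * ((y 1 - α * y 0) / (α * x 0 - x 1) *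
          bond u (reflection α (1 / 2) x) (reflection α (3 / 2) x)) := by
  -- The two reflections of `x` lie on one vertical line at distance μ - λ = 1 times the depth, so
  -- their bond sees only the second component of `u`.
  have hb : bond u (reflection α (1 / 2) x) (reflection α (3 / 2) x) =
      (u (reflection α (3 / 2) x) 1 - u (reflection α (1 / 2) x) 1) * (α * x 0 - x 1) := by
    simp only [bond_eq, reflection_apply_zero, reflection_apply_one]
    ring
  have hi : inner ℝ (u y - lowerExt α u x) (y - x) = (u y 0 - lowerExt α u x 0) * (y 0 - x 0) +
      (u y 1 - lowerExt α u x 1) * (y 1 - x 1) := by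
    simp [PiLp.inner_apply, Fin.sum_univ_two]
    ring
  have hc (c d : ℝ) : c / (α * x 0 - x 1) * (d * (α * x 0 - x 1)) = c * d := by field_simp
  rw [hb, hi, hc]
  simp only [bond_eq, lowerExt_apply_zero, lowerExt_apply_one, reflection_apply_zero,
    reflection_apply_one]
  ring

/-- The self-stress of the complete framework on three points and their centroid. -/
theorem bond_centroid (u : Plane → Plane) (a b z w : Plane) (hw : (3 : ℝ) • w = a + b + z) :
    bond u a b = 3 * bond u a w + 3 * bond u b w + 3 * bond u z w - bond u a z - bond u b z := by
  have h0 := congrArg (fun v : Plane => v 0) hw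
  have h1 := congrArg (fun v : Plane => v 1) hw
  simp only [PiLp.add_apply, PiLp.smul_apply, smul_eq_mul] at h0 h1
  have e0 : z 0 = 3 * w 0 - a 0 - b 0 := by linarith
  have e1 : z 1 = 3 * w 1 - a 1 - b 1 := by linarith
  simp only [bond_eq, e0, e1]
  ring

/-! ### Integral tools and domination by bonds. -/

/-- Homogeneity: centring at `x` and scaling by `t` reduces to the integral with `t = 1`, finite
because `r` exceeds the dimension. -/
theorem exists_lintegral_add_norm_rpow_le {r : ℝ} (hr : 2 < r) :
    ∃ C : ℝ≥0∞, C ≠ ∞ ∧ ∀ (x : Plane) (t : ℝ), 0 < t →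
      ∫⁻ y, ENNReal.ofReal ((t + ‖y - x‖) ^ (-r)) ≤ C * ENNReal.ofReal (t ^ (2 - r)) := by
  refine ⟨∫⁻ y : Plane, ENNReal.ofReal ((1 + ‖y‖) ^ (-r)), ?_, fun x t ht => ?_⟩
  · exact (finite_integral_one_add_norm (E := Plane) (by simpa using hr)).ne
  have h1 : ∫⁻ y : Plane, ENNReal.ofReal ((t + ‖y - x‖) ^ (-r)) =
      ∫⁻ y : Plane, ENNReal.ofReal ((t + ‖y‖) ^ (-r)) :=
    lintegral_sub_right_eq_self (fun y => ENNReal.ofReal ((t + ‖y‖) ^ (-r))) x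
  have hmap := Measure.map_addHaar_smul (volume : Measure Plane) ht.ne'
  have hmeas : Measurable fun y : Plane => ENNReal.ofReal ((t + ‖y‖) ^ (-r)) := by fun_prop
  have h2 : ∫⁻ y : Plane, ENNReal.ofReal ((t + ‖t • y‖) ^ (-r)) =
      ENNReal.ofReal (t ^ 2)⁻¹ * ∫⁻ y : Plane, ENNReal.ofReal ((t + ‖y‖) ^ (-r)) := by
    rw [← lintegral_map (f := fun y : Plane => ENNReal.ofReal ((t + ‖y‖) ^ (-r))) hmeas
      (measurable_const_smul t), hmap, lintegral_smul_measure]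
    simp
  have h3 : ∫⁻ y : Plane, ENNReal.ofReal ((t + ‖t • y‖) ^ (-r)) =
      ENNReal.ofReal (t ^ (-r)) * ∫⁻ y : Plane, ENNReal.ofReal ((1 + ‖y‖) ^ (-r)) := by
    rw [← lintegral_const_mul _ (by fun_prop)]
    refine lintegral_congr fun y => ?_
    rw [← ENNReal.ofReal_mul (by positivity), ← Real.mul_rpow ht.le (by positivity), norm_smul,
      Real.norm_of_nonneg ht.le]
    ring_nf
  rw [h1]
  have h4 : ENNReal.ofReal (t ^ 2) * ENNReal.ofReal (t ^ 2)⁻¹ = 1 := by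
    rw [← ENNReal.ofReal_mul (by positivity), mul_inv_cancel₀ (by positivity), ENNReal.ofReal_one]
  have h5 : ENNReal.ofReal (t ^ (2 - r)) = ENNReal.ofReal (t ^ 2) * ENNReal.ofReal (t ^ (-r)) := by
    rw [← ENNReal.ofReal_mul (by positivity), sub_eq_add_neg, Real.rpow_add ht]
    norm_num
  rw [h5, mul_comm, mul_assoc, ← h3, h2, ← mul_assoc, h4, one_mul]

theorem setLIntegral_setLIntegral_add (F G : Plane → Plane → ℝ≥0∞)
    (hF : Measurable fun z : Plane × Plane => F z.1 z.2) (S T : Set Plane) :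
    ∫⁻ x in S, ∫⁻ y in T, (F x y + G x y) =
      (∫⁻ x in S, ∫⁻ y in T, F x y) + ∫⁻ x in S, ∫⁻ y in T, G x y := by
  have h1 (x : Plane) :
      ∫⁻ y in T, (F x y + G x y) = (∫⁻ y in T, F x y) + ∫⁻ y in T, G x y :=
    lintegral_add_left (hF.comp measurable_prodMk_left) _
  simp only [h1]
  exact lintegral_add_left hF.lintegral_prod_right' _

/-- The constant in `ofReal_le_sum_bondKernel`. -/
noncomputable def bondConst (s p c M : ℝ) (m : ℕ) : ℝ≥0∞ :=
  ENNReal.ofReal (c ^ p * (m : ℝ) ^ (p - 1)) * ENNReal.ofReal (M ^ (2 + p * s + p))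

theorem bondConst_ne_top (s p c M : ℝ) (m : ℕ) : bondConst s p c M m ≠ ∞ :=
  ENNReal.mul_ne_top ENNReal.ofReal_ne_top ENNReal.ofReal_ne_top

/-- A quantity dominated by bonds of length at most `M ρ` is controlled by their energies. -/
theorem ofReal_le_sum_bondKernel {s p ρ c n M : ℝ} (hs : 0 < s) (hp : 1 < p) (hρ : 0 < ρ)
    (hc : 0 ≤ c) (u : Plane → Plane) {m : ℕ} (a b : Fin m → Plane)
    (h : |n| ≤ c * ∑ i, |bond u (a i) (b i)|) (hab : ∀ i, ‖b i - a i‖ ≤ M * ρ) :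
    ENNReal.ofReal (|n| ^ p / ρ ^ (2 + p * s + p)) ≤
      bondConst s p c M m * ∑ i, bondKernel s p u (a i) (b i) := by
  have hp0 : 0 < p := by linarith
  have hq : 0 < 2 + p * s + p := by positivity
  refine (ofReal_rpow_div_le_sum hp.le hρ.le hc _ h).trans ?_
  rw [bondConst, mul_assoc, Finset.mul_sum _ _ (ENNReal.ofReal (M ^ _))]
  gcongr with i
  exact ofReal_bond_div_le hp0 hq hρ u _ _ (hab i)

/-! ### Energy inside the lower angle. -/

theorem exists_bondKernel_lowerExt_le {s p : ℝ} (α : ℝ) (hs : 0 < s) (hp : 1 < p) :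
    ∃ K : ℝ≥0∞, K ≠ ∞ ∧ ∀ (u : Plane → Plane) (x y : Plane),
      bondKernel s p (lowerExt α u) x y ≤
        K * (bondKernel s p u (reflection α (1 / 2) x) (reflection α (1 / 2) y) +
          bondKernel s p u (reflection α (3 / 2) x) (reflection α (3 / 2) y)) := by
  have hp0 : 0 < p := by linarith
  -- 5/2 is the larger of k and |ℓ|; the length factor is the Lipschitz bound for the larger
  -- parameter 3/2.
  refine ⟨bondConst s p (5 / 2) (1 + |α| + 3 / 2 * (1 + |α|)) 2, bondConst_ne_top _ _ _ _ _,
    fun u x y => ?_⟩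
  rcases eq_or_ne x y with rfl | hxy
  · rw [bondKernel_self hp0]; exact zero_le
  have h0 : 0 < ‖y - x‖ := norm_pos_iff.2 (sub_ne_zero.2 hxy.symm)
  have h := ofReal_le_sum_bondKernel (c := 5 / 2) (n := bond (lowerExt α u) x y)
    (M := 1 + |α| + 3 / 2 * (1 + |α|)) hs hp h0 (by norm_num) u
    ![reflection α (1 / 2) x, reflection α (3 / 2) x]
    ![reflection α (1 / 2) y, reflection α (3 / 2) y] ?_ ?_
  · simp only [Fin.sum_univ_two, Matrix.cons_val_zero, Matrix.cons_val_one] at h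
    exact h
  · rw [bond_lowerExt]
    simp only [Fin.sum_univ_two, Matrix.cons_val_zero, Matrix.cons_val_one]
    refine (abs_sub _ _).trans ?_
    rw [abs_mul, abs_mul, abs_of_pos (by norm_num : (0 : ℝ) < 5 / 2),
      abs_of_pos (by norm_num : (0 : ℝ) < 3 / 2)]
    linarith [abs_nonneg (bond u (reflection α (3 / 2) x) (reflection α (3 / 2) y))]
  · rw [Fin.forall_fin_two]
    simp only [Matrix.cons_val_zero, Matrix.cons_val_one]
    refine ⟨(norm_reflection_sub_le (by norm_num) x y).trans ?_,
      norm_reflection_sub_le (by norm_num) x y⟩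
    have := abs_nonneg α
    gcongr
    norm_num

/-- Successive affine changes of variables in a double integral. -/
theorem exists_setLIntegral_setLIntegral_comp_le (A B : Plane ≃ₗ[ℝ] Plane) :
    ∃ C : ℝ≥0∞, C ≠ ∞ ∧ ∀ (F : Plane → Plane → ℝ≥0∞) (c : Plane → Plane) (S T S' T' : Set Plane),
      MeasurableSet S → MeasurableSet T → MeasurableSet S' → MeasurableSet T' →
      (∀ x ∈ S, A x ∈ T) → (∀ x ∈ S, ∀ y ∈ S', B y + c x ∈ T') →
      ∫⁻ x in S, ∫⁻ y in S', F (A x) (B y + c x) ≤ C * ∫⁻ x in T, ∫⁻ y in T', F x y := by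
  obtain ⟨C₁, hC₁, h₁⟩ := exists_setLIntegral_comp_affine_le A
  obtain ⟨C₂, hC₂, h₂⟩ := exists_setLIntegral_comp_affine_le B
  refine ⟨C₂ * C₁, ENNReal.mul_ne_top hC₂ hC₁, fun F c S T S' T' hS hT hS' hT' hA hB => ?_⟩
  calc ∫⁻ x in S, ∫⁻ y in S', F (A x) (B y + c x)
      ≤ ∫⁻ x in S, C₂ * ∫⁻ y in T', F (A x) y :=
        setLIntegral_mono' hS fun x hx => h₂ (F (A x)) (c x) S' T' hS' hT' (hB x hx)
    _ = C₂ * ∫⁻ x in S, ∫⁻ y in T', F (A x) y := lintegral_const_mul' _ _ hC₂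
    _ ≤ C₂ * (C₁ * ∫⁻ x in T, ∫⁻ y in T', F x y) := by
        gcongr
        simpa using h₁ (fun x => ∫⁻ y in T', F x y) 0 S T hS hT (by simpa using hA)
    _ = _ := by rw [mul_assoc]

/-- The part of the energy of the extension inside the lower angle. -/
theorem exists_lower_lower_le {s p : ℝ} (α : ℝ) (hs : 0 < s) (hp : 1 < p) :
    ∃ C : ℝ≥0∞, C ≠ ∞ ∧ ∀ u : Plane → Plane, Measurable u →
      ∫⁻ x in angleLower α, ∫⁻ y in angleLower α, bondKernel s p (lowerExt α u) x y ≤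
        C * ∫⁻ x in angle α, ∫⁻ y in angle α, bondKernel s p u x y := by
  have h12 : (1 / 2 : ℝ) ≠ 0 := by norm_num
  have h32 : (3 / 2 : ℝ) ≠ 0 := by norm_num
  obtain ⟨C₁, hC₁, h₁⟩ := exists_setLIntegral_setLIntegral_comp_le (reflectionEquiv α _ h12)
    (reflectionEquiv α _ h12)
  obtain ⟨C₂, hC₂, h₂⟩ := exists_setLIntegral_setLIntegral_comp_le (reflectionEquiv α _ h32)
    (reflectionEquiv α _ h32)
  obtain ⟨K, hK, hpt⟩ := exists_bondKernel_lowerExt_le α hs hp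
  refine ⟨K * (C₁ + C₂), ENNReal.mul_ne_top hK (ENNReal.add_ne_top.2 ⟨hC₁, hC₂⟩), fun u hu => ?_⟩
  have hL := measurableSet_angleLower α
  have hD := measurableSet_angle α
  have hmA : ∀ x ∈ angleLower α, reflection α (1 / 2) x ∈ angle α := fun x hx =>
    reflection_mem_angle (by norm_num) hx
  have hmB : ∀ x ∈ angleLower α, reflection α (3 / 2) x ∈ angle α := fun x hx =>
    reflection_mem_angle (by norm_num) hx
  have hA := measurable_reflection α (1 / 2)
  have e₁ := h₁ (bondKernel s p u) (fun _ => 0) _ _ _ _ hL hD hL hD hmA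
    (fun x _ y hy => by rw [add_zero]; exact hmA y hy)
  have e₂ := h₂ (bondKernel s p u) (fun _ => 0) _ _ _ _ hL hD hL hD hmB
    (fun x _ y hy => by rw [add_zero]; exact hmB y hy)
  simp only [add_zero, reflectionEquiv_apply] at e₁ e₂
  have hm : Measurable fun z : Plane × Plane =>
      bondKernel s p u (reflection α (1 / 2) z.1) (reflection α (1 / 2) z.2) :=
    measurable_bondKernel_comp hu (hA.comp measurable_fst) (hA.comp measurable_snd)
  calc _ ≤ ∫⁻ x in angleLower α, K * ∫⁻ y in angleLower α,
          (bondKernel s p u (reflection α (1 / 2) x) (reflection α (1 / 2) y) +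
          bondKernel s p u (reflection α (3 / 2) x) (reflection α (3 / 2) y)) := by
        refine lintegral_mono fun x => ?_
        rw [← lintegral_const_mul' _ _ hK]
        exact lintegral_mono fun y => hpt u x y
    _ = K * ((∫⁻ x in angleLower α, ∫⁻ y in angleLower α,
          bondKernel s p u (reflection α (1 / 2) x) (reflection α (1 / 2) y)) +
          ∫⁻ x in angleLower α, ∫⁻ y in angleLower α,
            bondKernel s p u (reflection α (3 / 2) x) (reflection α (3 / 2) y)) := by
        rw [lintegral_const_mul' _ _ hK]
        exact congrArg (K * ·) (setLIntegral_setLIntegral_add _ _ hm _ _)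
    _ ≤ K * (C₁ * (∫⁻ x in angle α, ∫⁻ y in angle α, bondKernel s p u x y) +
          C₂ * ∫⁻ x in angle α, ∫⁻ y in angle α, bondKernel s p u x y) :=
        mul_le_mul_right (add_le_add e₁ e₂) K
    _ = _ := by rw [mul_assoc, add_mul]

/-! ### The Hardy-type estimate, by averaging over an auxiliary point. -/

/-- The centroid of the two reflections of `x` and of `z`. -/
noncomputable def centroid (α : ℝ) (x z : Plane) : Plane :=
  (1 / 3 : ℝ) • (reflection α (1 / 2) x + reflection α (3 / 2) x + z)

theorem centroid_mem_angle {α : ℝ} {x z : Plane} (hx : x ∈ angleLower α) (hz : z ∈ angle α) :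
    centroid α x z ∈ angle α := by
  obtain ⟨ha0, ha1⟩ := reflection_mem_angle (η := 1 / 2) (by norm_num) hx
  obtain ⟨hb0, hb1⟩ := reflection_mem_angle (η := 3 / 2) (by norm_num) hx
  obtain ⟨hz0, hz1⟩ := hz
  constructor <;> simp only [centroid, PiLp.add_apply, PiLp.smul_apply, smul_eq_mul] <;> linarith

theorem measurable_centroid (α : ℝ) :
    Measurable fun z : Plane × Plane => centroid α z.1 z.2 := by
  have hA : Measurable fun z : Plane × Plane => reflection α (1 / 2) z.1 :=
    (measurable_reflection α (1 / 2)).comp measurable_fst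
  have hB : Measurable fun z : Plane × Plane => reflection α (3 / 2) z.1 :=
    (measurable_reflection α (3 / 2)).comp measurable_fst
  exact ((hA.add hB).add measurable_snd).const_smul (1 / 3 : ℝ)

theorem exists_lintegral_reflection_le (α : ℝ) {η : ℝ} (hη : 0 < η) :
    ∃ C : ℝ≥0∞, C ≠ ∞ ∧ ∀ F : Plane → Plane → ℝ≥0∞,
      ∫⁻ x in angleLower α, ∫⁻ z in angle α, F (reflection α η x) z ≤
        C * ∫⁻ x in angle α, ∫⁻ y in angle α, F x y := by
  obtain ⟨C, hC, h⟩ := exists_setLIntegral_setLIntegral_comp_le (reflectionEquiv α η hη.ne')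
    (LinearEquiv.refl ℝ Plane)
  refine ⟨C, hC, fun F => ?_⟩
  have e := h F (fun _ => 0) _ _ _ _ (measurableSet_angleLower α) (measurableSet_angle α)
    (measurableSet_angle α) (measurableSet_angle α) (fun x hx => reflection_mem_angle hη hx)
    (fun x _ z hz => by rw [add_zero]; exact hz)
  simp only [add_zero] at e
  exact e

/-- For fixed `x` the centroid is affine in `z` with linear part 1/3, so `z` is substituted first
and the dependence on `x` is only a translation. -/
theorem exists_lintegral_reflection_centroid_le (α : ℝ) {η : ℝ} (hη : 0 < η) :
    ∃ C : ℝ≥0∞, C ≠ ∞ ∧ ∀ F : Plane → Plane → ℝ≥0∞,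
      ∫⁻ x in angleLower α, ∫⁻ z in angle α, F (reflection α η x) (centroid α x z) ≤
        C * ∫⁻ x in angle α, ∫⁻ y in angle α, F x y := by
  obtain ⟨C, hC, h⟩ := exists_setLIntegral_setLIntegral_comp_le (reflectionEquiv α η hη.ne')
    (LinearEquiv.smulOfNeZero ℝ Plane (1 / 3 : ℝ) (by norm_num))
  refine ⟨C, hC, fun F => ?_⟩
  have hc (x z : Plane) : LinearEquiv.smulOfNeZero ℝ Plane (1 / 3 : ℝ) (by norm_num) z +
      (1 / 3 : ℝ) • (reflection α (1 / 2) x + reflection α (3 / 2) x) = centroid α x z := by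
    rw [centroid, LinearEquiv.smulOfNeZero_apply, ← smul_add, add_comm]
  have e := h F (fun x => (1 / 3 : ℝ) • (reflection α (1 / 2) x + reflection α (3 / 2) x)) _ _ _ _
    (measurableSet_angleLower α) (measurableSet_angle α) (measurableSet_angle α)
    (measurableSet_angle α) (fun x hx => reflection_mem_angle hη hx)
    (fun x hx z hz => by rw [hc]; exact centroid_mem_angle hx hz)
  simp only [hc] at e
  exact e

/-- Now `z` is kept and `x` is substituted. The two reflections average to the one with parameter 1,
so the centroid is 2/3 of that reflection plus `z / 3`. Exchanging the order of integration is what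
requires `F` to be measurable. -/
theorem exists_lintegral_centroid_le (α : ℝ) :
    ∃ C : ℝ≥0∞, C ≠ ∞ ∧ ∀ F : Plane → Plane → ℝ≥0∞,
      (Measurable fun z : Plane × Plane => F z.1 z.2) →
      ∫⁻ x in angleLower α, ∫⁻ z in angle α, F z (centroid α x z) ≤
        C * ∫⁻ x in angle α, ∫⁻ y in angle α, F x y := by
  let A : Plane ≃ₗ[ℝ] Plane := (reflectionEquiv α 1 one_ne_zero).trans
    (LinearEquiv.smulOfNeZero ℝ Plane (2 / 3 : ℝ) (by norm_num))
  obtain ⟨C, hC, h⟩ := exists_setLIntegral_setLIntegral_comp_le (LinearEquiv.refl ℝ Plane) A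
  refine ⟨C, hC, fun F hF => ?_⟩
  have hc (x z : Plane) : A x + (1 / 3 : ℝ) • z = centroid α x z := by
    have hA : A x = (2 / 3 : ℝ) • reflection α 1 x := rfl
    rw [hA, centroid]
    ext i
    fin_cases i <;> simp [reflection] <;> ring
  have e := h F (fun z => (1 / 3 : ℝ) • z) _ _ _ _ (measurableSet_angle α) (measurableSet_angle α)
    (measurableSet_angleLower α) (measurableSet_angle α) (fun x hx => hx)
    (fun z hz x hx => by rw [hc]; exact centroid_mem_angle hx hz)
  simp only [hc] at e
  rw [lintegral_lintegral_swap]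
  · exact e
  · exact (hF.comp (measurable_snd.prodMk (measurable_centroid α))).aemeasurable

/-- The centre of a ball in the upper angle, at distance comparable to the depth of `x`. -/
noncomputable def ballCenter (α : ℝ) (x : Plane) : Plane :=
  !₂[x 0 + (α * x 0 - x 1),
    α * (x 0 + (α * x 0 - x 1)) + (1 + |α|) * (α * x 0 - x 1)]

/-- With t the depth of `x`, the centre has first coordinate `x 0 + t` and height (1 + |α|) t above
the line. A displacement shorter than t lowers these by less than t and (1 + |α|) t. -/
theorem ball_subset_angle {α : ℝ} {x : Plane} (hx : x ∈ angleLower α) :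
    Metric.ball (ballCenter α x) (α * x 0 - x 1) ⊆ angle α := by
  intro z hz
  rw [mem_ball_iff_norm] at hz
  obtain ⟨hx0, hx1⟩ := hx
  have h0 := (abs_apply_le_norm _ 0).trans_lt hz
  have h1 := (abs_apply_le_norm _ 1).trans_lt hz
  simp only [PiLp.sub_apply, ballCenter, Matrix.cons_val_zero, Matrix.cons_val_one] at h0 h1
  set t := α * x 0 - x 1
  have h2 : |α * (z 0 - (x 0 + t))| ≤ |α| * t := by rw [abs_mul]; gcongr
  rw [abs_lt] at h0 h1
  rw [abs_le] at h2
  exact ⟨by linarith, by linarith⟩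

theorem norm_sub_reflection_le {α η : ℝ} (hη0 : 0 ≤ η) (hη : η ≤ 2) {x z : Plane}
    (hz : z ∈ Metric.ball (ballCenter α x) (α * x 0 - x 1)) :
    ‖z - reflection α η x‖ ≤ (6 + 2 * |α|) * (α * x 0 - x 1) := by
  rw [mem_ball_iff_norm] at hz
  have ht := (norm_nonneg _).trans hz.le
  have h0 := (abs_apply_le_norm _ 0).trans hz.le
  have h1 := (abs_apply_le_norm _ 1).trans hz.le
  refine (norm_le_abs_add_abs _).trans ?_
  simp only [PiLp.sub_apply, ballCenter, Matrix.cons_val_zero, Matrix.cons_val_one] at h0 h1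
  simp only [PiLp.sub_apply, reflection_apply_zero, reflection_apply_one]
  set t := α * x 0 - x 1
  have h2 : |α * t| ≤ |α| * t := by rw [abs_mul, abs_of_nonneg ht]
  have h3 : 0 ≤ η * t := by positivity
  have h4 : η * t ≤ 2 * t := by gcongr
  have h5 : 0 ≤ |α| * t := by positivity
  rw [abs_le] at h0 h1 h2
  have e0 : |z 0 - x 0| ≤ 2 * t := abs_le.2 ⟨by linarith, by linarith⟩
  have e1 : |z 1 - (α * x 0 + η * t)| ≤ (4 + 2 * |α|) * t :=
    abs_le.2 ⟨by linarith, by linarith⟩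
  linarith

/-- The five bonds of `bond_centroid`, with coefficients at most 3, all have length at most (6 +
2|α|) times the depth, so their kernels dominate the weight given by the depth. -/
theorem exists_bond_reflection_le {s p : ℝ} (α : ℝ) (hs : 0 < s) (hp : 1 < p) :
    ∃ K : ℝ≥0∞, K ≠ ∞ ∧ ∀ (u : Plane → Plane) (x z : Plane), x ∈ angleLower α →
      z ∈ Metric.ball (ballCenter α x) (α * x 0 - x 1) →
      ENNReal.ofReal (|bond u (reflection α (1 / 2) x) (reflection α (3 / 2) x)| ^ p /
          (α * x 0 - x 1) ^ (2 + p * s + p)) ≤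
        K * (bondKernel s p u (reflection α (1 / 2) x) (centroid α x z) +
          bondKernel s p u (reflection α (3 / 2) x) (centroid α x z) +
          bondKernel s p u z (centroid α x z) +
          bondKernel s p u (reflection α (1 / 2) x) z +
          bondKernel s p u (reflection α (3 / 2) x) z) := by
  refine ⟨bondConst s p 3 (6 + 2 * |α|) 5, bondConst_ne_top _ _ _ _ _, fun u x z hx hz => ?_⟩
  have ht : 0 < α * x 0 - x 1 := sub_pos.2 hx.2
  have hw : (3 : ℝ) • centroid α x z = reflection α (1 / 2) x + reflection α (3 / 2) x + z := by
    rw [centroid, smul_smul]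
    norm_num
  have hza := norm_sub_reflection_le (η := 1 / 2) (by norm_num) (by norm_num) hz
  have hzb := norm_sub_reflection_le (η := 3 / 2) (by norm_num) (by norm_num) hz
  have hba : ‖reflection α (3 / 2) x - reflection α (1 / 2) x‖ ≤
      (6 + 2 * |α|) * (α * x 0 - x 1) := by
    refine (norm_le_abs_add_abs _).trans ?_
    simp only [PiLp.sub_apply, reflection_apply_zero, reflection_apply_one]
    have e : α * x 0 + 3 / 2 * (α * x 0 - x 1) - (α * x 0 + 1 / 2 * (α * x 0 - x 1)) =
      α * x 0 - x 1 := by ring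
    rw [e, sub_self, abs_zero, abs_of_pos ht]
    have := mul_nonneg (abs_nonneg α) ht.le
    linarith
  generalize reflection α (1 / 2) x = a at *
  generalize reflection α (3 / 2) x = b at *
  generalize centroid α x z = w at *
  generalize α * x 0 - x 1 = t at *
  have hw' : w = (1 / 3 : ℝ) • (a + b + z) := by rw [← hw, smul_smul]; norm_num
  have hthird {v v' : Plane} (hv : ‖v‖ ≤ (6 + 2 * |α|) * t) (hv' : ‖v'‖ ≤ (6 + 2 * |α|) * t) :
      ‖(1 / 3 : ℝ) • (v + v')‖ ≤ (6 + 2 * |α|) * t := by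
    rw [norm_smul, Real.norm_of_nonneg (by norm_num)]
    have h1 := norm_add_le v v'
    have h2 := (norm_nonneg v).trans hv
    linarith
  have hwa : ‖w - a‖ ≤ (6 + 2 * |α|) * t := by
    have e : w - a = (1 / 3 : ℝ) • ((b - a) + (z - a)) := by rw [hw']; module
    rw [e]; exact hthird hba hza
  have hwb : ‖w - b‖ ≤ (6 + 2 * |α|) * t := by
    have e : w - b = (1 / 3 : ℝ) • ((a - b) + (z - b)) := by rw [hw']; module
    rw [e]; exact hthird (by rwa [norm_sub_rev]) hzb
  have hwz : ‖w - z‖ ≤ (6 + 2 * |α|) * t := by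
    have e : w - z = (1 / 3 : ℝ) • ((a - z) + (b - z)) := by rw [hw']; module
    rw [e]; exact hthird (by rwa [norm_sub_rev]) (by rwa [norm_sub_rev])
  have h := ofReal_le_sum_bondKernel (c := 3) (n := bond u a b) (M := 6 + 2 * |α|) hs hp ht
    (by norm_num) u ![a, b, z, a, b] ![w, w, w, z, z] ?_ ?_
  · simpa [Fin.sum_univ_five] using h
  · rw [bond_centroid u a b z w hw]
    simp [Fin.sum_univ_five]
    rw [abs_le]
    have := neg_abs_le (bond u a w)
    have := neg_abs_le (bond u b w)
    have := neg_abs_le (bond u z w)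
    have := neg_abs_le (bond u a z)
    have := neg_abs_le (bond u b z)
    have := le_abs_self (bond u a w)
    have := le_abs_self (bond u b w)
    have := le_abs_self (bond u z w)
    have := le_abs_self (bond u a z)
    have := le_abs_self (bond u b z)
    have := abs_nonneg (bond u a z)
    have := abs_nonneg (bond u b z)
    constructor <;> linarith
  · intro i
    fin_cases i
    · exact hwa
    · exact hwb
    · exact hwz
    · exact hza
    · exact hzb

/-- A Hardy-type bound for the increments between the two reflections. -/
theorem exists_lintegral_bond_reflection_le {s p : ℝ} (α : ℝ) (hs : 0 < s) (hp : 1 < p) :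
    ∃ C : ℝ≥0∞, C ≠ ∞ ∧ ∀ u : Plane → Plane, Measurable u →
      ∫⁻ x in angleLower α, ENNReal.ofReal
          (|bond u (reflection α (1 / 2) x) (reflection α (3 / 2) x)| ^ p /
            (α * x 0 - x 1) ^ (p * s + p)) ≤
        C * ∫⁻ x in angle α, ∫⁻ y in angle α, bondKernel s p u x y := by
  have h12 : (0 : ℝ) < 1 / 2 := by norm_num
  have h32 : (0 : ℝ) < 3 / 2 := by norm_num
  obtain ⟨K, hK, hpt⟩ := exists_bond_reflection_le (s := s) (p := p) α hs hp
  obtain ⟨C₁, hC₁, h₁⟩ := exists_lintegral_reflection_centroid_le α h12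
  obtain ⟨C₂, hC₂, h₂⟩ := exists_lintegral_reflection_centroid_le α h32
  obtain ⟨C₃, hC₃, h₃⟩ := exists_lintegral_centroid_le α
  obtain ⟨C₄, hC₄, h₄⟩ := exists_lintegral_reflection_le α h12
  obtain ⟨C₅, hC₅, h₅⟩ := exists_lintegral_reflection_le α h32
  let V : ℝ≥0∞ := volume (Metric.ball (0 : Plane) 1)
  have hV0 : V ≠ 0 := (Metric.measure_ball_pos _ _ one_pos).ne'
  have hV : V ≠ ∞ := measure_ball_lt_top.ne
  refine ⟨V⁻¹ * (K * (C₁ + C₂ + C₃ + C₄ + C₅)), ENNReal.mul_ne_top (ENNReal.inv_ne_top.2 hV0)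
    (ENNReal.mul_ne_top hK (by simp [*])), fun u hu => ?_⟩
  let F₁ : Plane → Plane → ℝ≥0∞ := fun x z =>
    bondKernel s p u (reflection α (1 / 2) x) (centroid α x z)
  let F₂ : Plane → Plane → ℝ≥0∞ := fun x z =>
    bondKernel s p u (reflection α (3 / 2) x) (centroid α x z)
  let F₃ : Plane → Plane → ℝ≥0∞ := fun x z => bondKernel s p u z (centroid α x z)
  let F₄ : Plane → Plane → ℝ≥0∞ := fun x z => bondKernel s p u (reflection α (1 / 2) x) z
  let F₅ : Plane → Plane → ℝ≥0∞ := fun x z => bondKernel s p u (reflection α (3 / 2) x) z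
  have hA := measurable_reflection α (1 / 2)
  have hB := measurable_reflection α (3 / 2)
  have m₁ : Measurable fun z : Plane × Plane => F₁ z.1 z.2 :=
    measurable_bondKernel_comp hu (hA.comp measurable_fst) (measurable_centroid α)
  have m₂ : Measurable fun z : Plane × Plane => F₂ z.1 z.2 :=
    measurable_bondKernel_comp hu (hB.comp measurable_fst) (measurable_centroid α)
  have m₃ : Measurable fun z : Plane × Plane => F₃ z.1 z.2 :=
    measurable_bondKernel_comp hu measurable_snd (measurable_centroid α)
  have m₄ : Measurable fun z : Plane × Plane => F₄ z.1 z.2 :=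
    measurable_bondKernel_comp hu (hA.comp measurable_fst) measurable_snd
  have hk : Measurable fun z : Plane × Plane => bondKernel s p u z.1 z.2 :=
    measurable_bondKernel_comp hu measurable_fst measurable_snd
  have e₁ : ∫⁻ x in angleLower α, ∫⁻ z in angle α, F₁ x z ≤ _ := h₁ (bondKernel s p u)
  have e₂ : ∫⁻ x in angleLower α, ∫⁻ z in angle α, F₂ x z ≤ _ := h₂ (bondKernel s p u)
  have e₃ : ∫⁻ x in angleLower α, ∫⁻ z in angle α, F₃ x z ≤ _ := h₃ (bondKernel s p u) hk
  have e₄ : ∫⁻ x in angleLower α, ∫⁻ z in angle α, F₄ x z ≤ _ := h₄ (bondKernel s p u)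
  have e₅ : ∫⁻ x in angleLower α, ∫⁻ z in angle α, F₅ x z ≤ _ := h₅ (bondKernel s p u)
  have hsum : ∫⁻ x in angleLower α, ∫⁻ z in angle α, (F₁ x z + F₂ x z + F₃ x z + F₄ x z + F₅ x z) ≤
      (C₁ + C₂ + C₃ + C₄ + C₅) * ∫⁻ x in angle α, ∫⁻ y in angle α, bondKernel s p u x y := by
    rw [setLIntegral_setLIntegral_add _ _ (((m₁.add m₂).add m₃).add m₄),
      setLIntegral_setLIntegral_add _ _ ((m₁.add m₂).add m₃),
      setLIntegral_setLIntegral_add _ _ (m₁.add m₂), setLIntegral_setLIntegral_add _ _ m₁]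
    simp only [add_mul]
    exact add_le_add (add_le_add (add_le_add (add_le_add e₁ e₂) e₃) e₄) e₅
  -- The unit ball's volume is moved to the left, where integrating a constant over the ball of
  -- radius t produces it.
  rw [mul_assoc, ← ENNReal.mul_le_iff_le_inv hV0 hV, ← lintegral_const_mul' _ _ hV]
  calc _ ≤ ∫⁻ x in angleLower α, K * ∫⁻ z in angle α,
          (F₁ x z + F₂ x z + F₃ x z + F₄ x z + F₅ x z) := by
        refine setLIntegral_mono' (measurableSet_angleLower α) fun x hx => ?_
        have ht : 0 < α * x 0 - x 1 := sub_pos.2 hx.2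
        have hball : volume (Metric.ball (ballCenter α x) (α * x 0 - x 1)) =
            ENNReal.ofReal ((α * x 0 - x 1) ^ 2) * V := by
          rw [Measure.addHaar_ball _ _ ht.le]
          simp [V]
        rw [← lintegral_const_mul' _ _ hK]
        -- Only `z` in the ball is retained. The left side of the pointwise bound does not depend on
        -- `z`, and the factor t² of the ball's area reduces the exponent 2 + ps + p to ps + p.
        refine le_trans ?_ (lintegral_mono_set (ball_subset_angle hx))
        refine le_trans ?_ (setLIntegral_mono' measurableSet_ball fun z hz => hpt u x z hx hz)
        rw [setLIntegral_const, hball, mul_comm (ENNReal.ofReal _) V, mul_left_comm]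
        gcongr
        rw [← ENNReal.ofReal_mul (by positivity)]
        refine ENNReal.ofReal_le_ofReal (le_of_eq ?_)
        rw [add_assoc 2, Real.rpow_add ht 2, Real.rpow_two]
        field_simp
    _ = K * ∫⁻ x in angleLower α, ∫⁻ z in angle α,
          (F₁ x z + F₂ x z + F₃ x z + F₄ x z + F₅ x z) := lintegral_const_mul' _ _ hK
    _ ≤ _ := by
        rw [mul_assoc]
        exact mul_le_mul_right hsum K

/-! ### Interaction between the two angles. -/

/-- Depth plus height is the increment from `x` to `y` of the linear form `v 1 - α * v 0`. For
points in opposite angles both terms are positive, so |y - x| controls each. -/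
theorem depth_add_height_le {α : ℝ} {x y : Plane} :
    (α * x 0 - x 1) + (y 1 - α * y 0) ≤ (1 + |α|) * ‖y - x‖ := by
  have h0 := abs_apply_le_norm (y - x) 0
  have h1 := abs_apply_le_norm (y - x) 1
  simp only [PiLp.sub_apply] at h0 h1
  have h2 : |α * (y 0 - x 0)| ≤ |α| * ‖y - x‖ := by rw [abs_mul]; gcongr
  rw [abs_le] at h1 h2
  linarith

theorem norm_sub_reflection_le_of_mem_angle {α η : ℝ} (hη0 : 0 ≤ η) (hη : η ≤ 2) {x y : Plane}
    (hx : x ∈ angleLower α) (hy : y ∈ angle α) :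
    ‖y - reflection α η x‖ ≤ (3 + 3 * |α|) * ‖y - x‖ := by
  have ht : 0 < α * x 0 - x 1 := sub_pos.2 hx.2
  have hτ : 0 < y 1 - α * y 0 := sub_pos.2 hy.2
  have hd := depth_add_height_le (α := α) (x := x) (y := y)
  have h0 := abs_apply_le_norm (y - x) 0
  refine (norm_le_abs_add_abs _).trans ?_
  simp only [PiLp.sub_apply] at h0
  simp only [PiLp.sub_apply, reflection_apply_zero, reflection_apply_one]
  have h2 : |α * (y 0 - x 0)| ≤ |α| * ‖y - x‖ := by rw [abs_mul]; gcongr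
  rw [abs_le] at h2
  set t := α * x 0 - x 1
  have h3 : 0 ≤ η * t := by positivity
  have h4 : η * t ≤ 2 * t := by gcongr
  have e1 : |y 1 - (α * x 0 + η * t)| ≤ (2 + 3 * |α|) * ‖y - x‖ :=
    abs_le.2 ⟨by linarith, by linarith⟩
  linarith

/-- In the error term the height of `y`, at most a multiple of |y - x|, absorbs p powers of the
weight. Since the depth t is bounded likewise, the remaining |y - x| may be replaced by t + |y - x|,
which removes the singularity. -/
theorem exists_cross_kernel_le {s p : ℝ} (α : ℝ) (hs : 0 < s) (hp : 1 < p) :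
    ∃ K : ℝ≥0∞, K ≠ ∞ ∧ ∀ (u : Plane → Plane) (x y : Plane), x ∈ angleLower α → y ∈ angle α →
      ENNReal.ofReal (|inner ℝ (u y - lowerExt α u x) (y - x)| ^ p / ‖y - x‖ ^ (2 + p * s + p)) ≤
        K * (bondKernel s p u (reflection α (1 / 2) x) y +
          bondKernel s p u (reflection α (3 / 2) x) y +
          ENNReal.ofReal (|bond u (reflection α (1 / 2) x) (reflection α (3 / 2) x)| ^ p /
            (α * x 0 - x 1) ^ p) *
            ENNReal.ofReal ((α * x 0 - x 1 + ‖y - x‖) ^ (-(2 + p * s)))) := by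
  have hp0 : 0 < p := by linarith
  have hq : 0 < 2 + p * s + p := by positivity
  -- `K₁` is the power-mean constant for three terms with largest coefficient 15/4, `K₂` compares
  -- the lengths to the reflected points with |y - x|, and `K₃` collects height ≤ (1 + |α|)|y - x|
  -- and t + |y - x| ≤ (2 + |α|)|y - x|.
  let K₁ : ℝ≥0∞ := ENNReal.ofReal ((15 / 4) ^ p * ((3 : ℕ) : ℝ) ^ (p - 1))
  let K₂ : ℝ≥0∞ := ENNReal.ofReal ((3 + 3 * |α|) ^ (2 + p * s + p))
  let K₃ : ℝ≥0∞ := ENNReal.ofReal ((1 + |α|) ^ p * (2 + |α|) ^ (2 + p * s))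
  refine ⟨K₁ * (K₂ + K₃), by simp [K₁, K₂, K₃, ENNReal.mul_eq_top], fun u x y hx hy => ?_⟩
  have ht : 0 < α * x 0 - x 1 := sub_pos.2 hx.2
  have hτ : 0 < y 1 - α * y 0 := sub_pos.2 hy.2
  have hd := depth_add_height_le (α := α) (x := x) (y := y)
  have ha := norm_sub_reflection_le_of_mem_angle (η := 1 / 2) (by norm_num) (by norm_num) hx hy
  have hb := norm_sub_reflection_le_of_mem_angle (η := 3 / 2) (by norm_num) (by norm_num) hx hy
  have hi := inner_lowerExt_sub α u x y ht.ne'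
  have hρ : 0 < ‖y - x‖ := by
    by_contra h
    have := norm_nonneg (y - x)
    nlinarith [abs_nonneg α]
  generalize reflection α (1 / 2) x = a at *
  generalize reflection α (3 / 2) x = b at *
  generalize inner ℝ (u y - lowerExt α u x) (y - x) = n at *
  generalize α * x 0 - x 1 = t at *
  generalize y 1 - α * y 0 = τ at *
  have h := ofReal_rpow_div_le_sum (q := 2 + p * s + p) (c := 15 / 4) (n := n) hp.le hρ.le
    (by norm_num) ![bond u a y, bond u b y, τ / t * bond u a b] ?_
  · refine h.trans ?_
    rw [mul_assoc]
    refine mul_le_mul_right ?_ K₁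
    simp only [Fin.sum_univ_three, Matrix.cons_val_zero, Matrix.cons_val_one, Matrix.cons_val]
    rw [mul_add]
    have e₁ := ofReal_bond_div_le hp0 hq hρ u a y ha
    have e₂ := ofReal_bond_div_le hp0 hq hρ u b y hb
    have e₃ : ENNReal.ofReal (|τ / t * bond u a b| ^ p / ‖y - x‖ ^ (2 + p * s + p)) ≤
        K₃ * (ENNReal.ofReal (|bond u a b| ^ p / t ^ p) *
          ENNReal.ofReal ((t + ‖y - x‖) ^ (-(2 + p * s)))) := by
      generalize ‖y - x‖ = ρ at *
      rw [← ENNReal.ofReal_mul (by positivity), ← ENNReal.ofReal_mul (by positivity)]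
      refine ENNReal.ofReal_le_ofReal ?_
      have hτρ : τ ^ p ≤ (1 + |α|) ^ p * ρ ^ p := by
        rw [← Real.mul_rpow (by positivity) hρ.le]
        exact Real.rpow_le_rpow hτ.le (by linarith) hp0.le
      have htρ : (t + ρ) ^ (2 + p * s) ≤ (2 + |α|) ^ (2 + p * s) * ρ ^ (2 + p * s) := by
        rw [← Real.mul_rpow (by positivity) hρ.le]
        exact Real.rpow_le_rpow (by positivity) (by linarith) (by positivity)
      rw [abs_mul, abs_of_pos (div_pos hτ ht), Real.mul_rpow (by positivity) (abs_nonneg _),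
        Real.div_rpow hτ.le ht.le, Real.rpow_add hρ, Real.rpow_neg (by positivity)]
      have p1 : 0 < t ^ p := Real.rpow_pos_of_pos ht p
      have p2 : 0 < ρ ^ p := Real.rpow_pos_of_pos hρ p
      have p3 : 0 < ρ ^ (2 + p * s) := Real.rpow_pos_of_pos hρ _
      have p4 : 0 < (t + ρ) ^ (2 + p * s) := Real.rpow_pos_of_pos (by positivity) _
      have p5 : 0 ≤ |bond u a b| ^ p := by positivity
      have q1 : τ ^ p / ρ ^ p ≤ (1 + |α|) ^ p := by rwa [div_le_iff₀ p2]
      have q2 : (ρ ^ (2 + p * s))⁻¹ ≤ (2 + |α|) ^ (2 + p * s) * ((t + ρ) ^ (2 + p * s))⁻¹ := by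
        rw [← div_eq_mul_inv, le_div_iff₀ p4, inv_mul_le_iff₀ p3]
        linarith
      calc τ ^ p / t ^ p * |bond u a b| ^ p / (ρ ^ (2 + p * s) * ρ ^ p)
          = (τ ^ p / ρ ^ p) * (|bond u a b| ^ p / t ^ p) * (ρ ^ (2 + p * s))⁻¹ := by
            field_simp
        _ ≤ (1 + |α|) ^ p * (|bond u a b| ^ p / t ^ p) *
              ((2 + |α|) ^ (2 + p * s) * ((t + ρ) ^ (2 + p * s))⁻¹) := by
            gcongr
        _ = _ := by ring
    refine add_le_add ?_ (e₃.trans (mul_le_mul_left le_add_self _))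
    refine (add_le_add e₁ e₂).trans ?_
    rw [← mul_add]
    exact mul_le_mul_left le_self_add _
  · rw [hi]
    simp only [Fin.sum_univ_three, Matrix.cons_val_zero, Matrix.cons_val_one, Matrix.cons_val]
    generalize τ / t * bond u a b = d
    rw [abs_le]
    have := neg_abs_le (bond u a y)
    have := neg_abs_le (bond u b y)
    have := neg_abs_le d
    have := le_abs_self (bond u a y)
    have := le_abs_self (bond u b y)
    have := le_abs_self d
    have := abs_nonneg (bond u a y)
    have := abs_nonneg (bond u b y)
    constructor <;> linarith

/-- The part of the energy of the extension between the two angles. -/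
theorem exists_lower_upper_le {s p : ℝ} (α : ℝ) (hs : 0 < s) (hp : 1 < p) :
    ∃ C : ℝ≥0∞, C ≠ ∞ ∧ ∀ u : Plane → Plane, Measurable u →
      ∫⁻ x in angleLower α, ∫⁻ y in angle α, ENNReal.ofReal
          (|inner ℝ (u y - lowerExt α u x) (y - x)| ^ p / ‖y - x‖ ^ (2 + p * s + p)) ≤
        C * ∫⁻ x in angle α, ∫⁻ y in angle α, bondKernel s p u x y := by
  have h12 : (0 : ℝ) < 1 / 2 := by norm_num
  have h32 : (0 : ℝ) < 3 / 2 := by norm_num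
  have hr : 2 < 2 + p * s := by nlinarith
  obtain ⟨K, hK, hpt⟩ := exists_cross_kernel_le (s := s) (p := p) α hs hp
  obtain ⟨C₁, hC₁, h₁⟩ := exists_lintegral_reflection_le α h12
  obtain ⟨C₂, hC₂, h₂⟩ := exists_lintegral_reflection_le α h32
  obtain ⟨C₃, hC₃, h₃⟩ := exists_lintegral_bond_reflection_le (s := s) (p := p) α hs hp
  obtain ⟨C₄, hC₄, h₄⟩ := exists_lintegral_add_norm_rpow_le hr
  refine ⟨K * (C₁ + C₂ + C₄ * C₃), by simp [*, ENNReal.mul_eq_top], fun u hu => ?_⟩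
  let F₁ : Plane → Plane → ℝ≥0∞ := fun x y => bondKernel s p u (reflection α (1 / 2) x) y
  let F₂ : Plane → Plane → ℝ≥0∞ := fun x y => bondKernel s p u (reflection α (3 / 2) x) y
  let F₃ : Plane → Plane → ℝ≥0∞ := fun x y =>
    ENNReal.ofReal (|bond u (reflection α (1 / 2) x) (reflection α (3 / 2) x)| ^ p /
      (α * x 0 - x 1) ^ p) * ENNReal.ofReal ((α * x 0 - x 1 + ‖y - x‖) ^ (-(2 + p * s)))
  have hA := measurable_reflection α (1 / 2)
  have hB := measurable_reflection α (3 / 2)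
  have m₁ : Measurable fun z : Plane × Plane => F₁ z.1 z.2 :=
    measurable_bondKernel_comp hu (hA.comp measurable_fst) measurable_snd
  have m₂ : Measurable fun z : Plane × Plane => F₂ z.1 z.2 :=
    measurable_bondKernel_comp hu (hB.comp measurable_fst) measurable_snd
  have e₁ : ∫⁻ x in angleLower α, ∫⁻ y in angle α, F₁ x y ≤ _ := h₁ (bondKernel s p u)
  have e₂ : ∫⁻ x in angleLower α, ∫⁻ y in angle α, F₂ x y ≤ _ := h₂ (bondKernel s p u)
  have e₃ : ∫⁻ x in angleLower α, ∫⁻ y in angle α, F₃ x y ≤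
      C₄ * (C₃ * ∫⁻ x in angle α, ∫⁻ y in angle α, bondKernel s p u x y) := by
    refine le_trans ?_ (mul_le_mul_right (h₃ u hu) C₄)
    rw [← lintegral_const_mul' _ _ hC₄]
    refine setLIntegral_mono' (measurableSet_angleLower α) fun x hx => ?_
    have ht : 0 < α * x 0 - x 1 := sub_pos.2 hx.2
    -- Integration in `y` over the whole plane yields t^(-ps), which with t^(-p) is the Hardy
    -- weight.
    refine (setLIntegral_le_lintegral _ _).trans ?_
    simp only [F₃]
    rw [lintegral_const_mul' _ _ ENNReal.ofReal_ne_top]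
    refine (mul_le_mul_right (h₄ x _ ht) _).trans ?_
    rw [mul_left_comm, ← ENNReal.ofReal_mul (by positivity)]
    refine mul_le_mul_right (ENNReal.ofReal_le_ofReal (le_of_eq ?_)) _
    have e : 2 - (2 + p * s) = -(p * s) := by ring
    rw [e, Real.rpow_neg ht.le, Real.rpow_add ht]
    have p1 := Real.rpow_pos_of_pos ht p
    have p2 := Real.rpow_pos_of_pos ht (p * s)
    field_simp
  calc _ ≤ ∫⁻ x in angleLower α, K * ∫⁻ y in angle α, (F₁ x y + F₂ x y + F₃ x y) := by
        refine setLIntegral_mono' (measurableSet_angleLower α) fun x hx => ?_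
        rw [← lintegral_const_mul' _ _ hK]
        exact setLIntegral_mono' (measurableSet_angle α) fun y hy => hpt u x y hx hy
    _ = K * ∫⁻ x in angleLower α, ∫⁻ y in angle α, (F₁ x y + F₂ x y + F₃ x y) :=
        lintegral_const_mul' _ _ hK
    _ ≤ _ := by
        rw [mul_assoc, setLIntegral_setLIntegral_add _ _ (m₁.add m₂),
          setLIntegral_setLIntegral_add _ _ m₁, add_mul, add_mul, mul_assoc]
        exact mul_le_mul_right (add_le_add (add_le_add e₁ e₂) e₃) K

/-! ### The glued extension: energy and Lebesgue bounds. -/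

open Classical in
/-- The modified Nitsche extension from the upper angle. -/
noncomputable def angleExt (α : ℝ) (u : Plane → Plane) (x : Plane) : Plane :=
  if x ∈ angle α then u x else lowerExt α u x

theorem angleExt_of_mem {α : ℝ} {u : Plane → Plane} {x : Plane} (hx : x ∈ angle α) :
    angleExt α u x = u x := by
  rw [angleExt, if_pos hx]

theorem angleExt_of_mem_angleLower {α : ℝ} {u : Plane → Plane} {x : Plane}
    (hx : x ∈ angleLower α) : angleExt α u x = lowerExt α u x := by
  rw [angleExt, if_neg fun h => lt_asymm h.2 hx.2]

theorem lowerExt_add (α : ℝ) (u v : Plane → Plane) :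
    lowerExt α (u + v) = lowerExt α u + lowerExt α v := by
  funext x
  ext i
  fin_cases i <;> simp [lowerExt_apply] <;> ring

theorem lowerExt_smul (α c : ℝ) (u : Plane → Plane) :
    lowerExt α (c • u) = c • lowerExt α u := by
  funext x
  ext i
  fin_cases i <;> simp [lowerExt_apply] <;> ring

theorem angleExt_add (α : ℝ) (u v : Plane → Plane) :
    angleExt α (u + v) = angleExt α u + angleExt α v := by
  funext x
  by_cases hx : x ∈ angle α <;> simp [angleExt, hx, lowerExt_add]

theorem angleExt_smul (α c : ℝ) (u : Plane → Plane) :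
    angleExt α (c • u) = c • angleExt α u := by
  funext x
  by_cases hx : x ∈ angle α <;> simp [angleExt, hx, lowerExt_smul]

theorem angleExt_sub (α : ℝ) (u v : Plane → Plane) :
    angleExt α (u - v) = angleExt α u - angleExt α v := by
  have h : u - v = u + (-1 : ℝ) • v := by simp [sub_eq_add_neg]
  rw [h, angleExt_add, angleExt_smul]
  simp [sub_eq_add_neg]

theorem measurable_lowerExt (α : ℝ) {u : Plane → Plane} (hu : Measurable u) :
    Measurable (lowerExt α u) := by
  have h (η : ℝ) (i : Fin 2) : Measurable fun x => u (reflection α η x) i := by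
    have h1 : Measurable fun v : Plane => v i := by fun_prop
    exact h1.comp (hu.comp (measurable_reflection α η))
  have h1 : Measurable fun x => (![lowerExt α u x 0, lowerExt α u x 1] : Fin 2 → ℝ) := by
    refine measurable_pi_iff.2 fun i => ?_
    fin_cases i
    · simp only [lowerExt_apply_zero, Matrix.cons_val_zero, Fin.zero_eta]
      exact (((h _ 0).const_mul _).sub ((h _ 0).const_mul _)).add
        (((h _ 1).sub (h _ 1)).const_mul _)
    · simp only [lowerExt_apply_one, Matrix.cons_val_one, Fin.mk_one, Matrix.cons_val_fin_one]
      exact ((h _ 1).const_mul _).add ((h _ 1).const_mul _)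
  have h2 := (WithLp.measurable_toLp 2 (Fin 2 → ℝ)).comp h1
  convert h2 using 1
  funext x
  ext i
  fin_cases i <;> simp

theorem measurable_angleExt (α : ℝ) {u : Plane → Plane} (hu : Measurable u) :
    Measurable (angleExt α u) :=
  Measurable.ite (measurableSet_angle α) hu (measurable_lowerExt α hu)

theorem angle_subset_halfPlane (α : ℝ) : angle α ⊆ halfPlane := fun _ hx => hx.1

theorem angleLower_subset_halfPlane (α : ℝ) : angleLower α ⊆ halfPlane := fun _ hx => hx.1

theorem volume_line (α : ℝ) : volume {x : Plane | α * x 0 = x 1} = 0 := by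
  let S : Submodule ℝ Plane :=
    { carrier := {x : Plane | α * x 0 = x 1}
      zero_mem' := by simp
      add_mem' := fun {x y} (hx : α * x 0 = x 1) (hy : α * y 0 = y 1) => by
        change α * (x + y) 0 = (x + y) 1
        simp only [PiLp.add_apply]
        linarith
      smul_mem' := fun c {x} (hx : α * x 0 = x 1) => by
        change α * (c • x) 0 = (c • x) 1
        simp only [PiLp.smul_apply, smul_eq_mul]
        rw [← hx]; ring }
  refine Measure.addHaar_submodule volume S fun h => ?_
  have h1 : (!₂[0, 1] : Plane) ∈ S := h ▸ Submodule.mem_top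
  have h2 : α * (!₂[0, 1] : Plane) 0 = (!₂[0, 1] : Plane) 1 := h1
  simp at h2

theorem restrict_halfPlane_le (α : ℝ) :
    (volume : Measure Plane).restrict halfPlane ≤
      volume.restrict (angle α) + volume.restrict (angleLower α) := by
  refine le_trans (Measure.restrict_mono_ae ?_) (Measure.restrict_union_le _ _)
  have h : ∀ᵐ x : Plane, ¬ α * x 0 = x 1 := by
    rw [ae_iff]
    simpa using volume_line α
  filter_upwards [h] with x hx hx0
  rcases lt_or_gt_of_ne hx with h1 | h1
  · exact Or.inl ⟨hx0, h1⟩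
  · exact Or.inr ⟨hx0, h1⟩

theorem exists_energy_angleExt_le {s p : ℝ} (α : ℝ) (hs : 0 < s) (hp : 1 < p) :
    ∃ C : ℝ≥0∞, C ≠ ∞ ∧ ∀ u : Plane → Plane, Measurable u →
      energy s p halfPlane (angleExt α u) ≤ C * energy s p (angle α) u := by
  have hp0 : 0 < p := by linarith
  obtain ⟨C₁, hC₁, h₁⟩ := exists_lower_lower_le (s := s) (p := p) α hs hp
  obtain ⟨C₂, hC₂, h₂⟩ := exists_lower_upper_le (s := s) (p := p) α hs hp
  -- One summand for each block: upper-upper, upper-lower, lower-upper, lower-lower. The two mixed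
  -- blocks agree by symmetry.
  refine ⟨1 + C₂ + (C₂ + C₁), by simp [*], fun u hu => ?_⟩
  rw [energy_eq hp0, energy_eq hp0]
  have hD := measurableSet_angle α
  have hL := measurableSet_angleLower α
  have hv := measurable_angleExt α hu
  have hk : Measurable fun z : Plane × Plane => bondKernel s p (angleExt α u) z.1 z.2 :=
    measurable_bondKernel_comp hv measurable_fst measurable_snd
  have hDD : ∫⁻ x in angle α, ∫⁻ y in angle α, bondKernel s p (angleExt α u) x y =
      ∫⁻ x in angle α, ∫⁻ y in angle α, bondKernel s p u x y := by
    refine setLIntegral_congr_fun hD fun x hx => setLIntegral_congr_fun hD fun y hy => ?_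
    simp only [bondKernel, bond, angleExt_of_mem hx, angleExt_of_mem hy]
  have hLL : ∫⁻ x in angleLower α, ∫⁻ y in angleLower α, bondKernel s p (angleExt α u) x y =
      ∫⁻ x in angleLower α, ∫⁻ y in angleLower α, bondKernel s p (lowerExt α u) x y := by
    refine setLIntegral_congr_fun hL fun x hx => setLIntegral_congr_fun hL fun y hy => ?_
    simp only [bondKernel, bond, angleExt_of_mem_angleLower hx, angleExt_of_mem_angleLower hy]
  have hLD : ∫⁻ x in angleLower α, ∫⁻ y in angle α, bondKernel s p (angleExt α u) x y =
      ∫⁻ x in angleLower α, ∫⁻ y in angle α, ENNReal.ofReal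
        (|inner ℝ (u y - lowerExt α u x) (y - x)| ^ p / ‖y - x‖ ^ (2 + p * s + p)) := by
    refine setLIntegral_congr_fun hL fun x hx => setLIntegral_congr_fun hD fun y hy => ?_
    simp only [bondKernel, bond, angleExt_of_mem_angleLower hx, angleExt_of_mem hy]
  have hDL : ∫⁻ x in angle α, ∫⁻ y in angleLower α, bondKernel s p (angleExt α u) x y =
      ∫⁻ x in angleLower α, ∫⁻ y in angle α, bondKernel s p (angleExt α u) x y := by
    rw [lintegral_lintegral_swap hk.aemeasurable]
    simp only [bondKernel_comm s p (angleExt α u)]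
  have hμ := restrict_halfPlane_le α
  calc _ ≤ ∫⁻ x, ∫⁻ y, bondKernel s p (angleExt α u) x y
            ∂(volume.restrict (angle α) + volume.restrict (angleLower α))
            ∂(volume.restrict (angle α) + volume.restrict (angleLower α)) :=
        lintegral_mono' hμ fun x => lintegral_mono' hμ le_rfl
    _ = (∫⁻ x in angle α, ∫⁻ y in angle α, bondKernel s p (angleExt α u) x y) +
          (∫⁻ x in angle α, ∫⁻ y in angleLower α, bondKernel s p (angleExt α u) x y) +
          ((∫⁻ x in angleLower α, ∫⁻ y in angle α, bondKernel s p (angleExt α u) x y) +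
          ∫⁻ x in angleLower α, ∫⁻ y in angleLower α, bondKernel s p (angleExt α u) x y) := by
        simp only [lintegral_add_measure]
        rw [lintegral_add_left hk.lintegral_prod_right', lintegral_add_left hk.lintegral_prod_right']
    _ ≤ _ := by
        rw [hDD, hDL, hLL, hLD, add_mul, add_mul, add_mul, one_mul]
        exact add_le_add (add_le_add le_rfl (h₂ u hu)) (add_le_add (h₂ u hu) (h₁ u hu))

theorem exists_seminormX_angleExt_le {s p : ℝ} (α : ℝ) (hs : 0 < s) (hp : 1 < p) :
    ∃ C : ℝ≥0∞, C ≠ ∞ ∧ ∀ u : Plane → Plane, Measurable u →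
      seminormX s p halfPlane (angleExt α u) ≤ C * seminormX s p (angle α) u := by
  obtain ⟨C, hC, h⟩ := exists_energy_angleExt_le (s := s) (p := p) α hs hp
  have hp' : 0 ≤ 1 / p := by positivity
  refine ⟨C ^ (1 / p), ENNReal.rpow_ne_top_of_nonneg hp' hC, fun u hu => ?_⟩
  rw [seminormX, seminormX, ← ENNReal.mul_rpow_of_nonneg _ _ hp']
  exact ENNReal.rpow_le_rpow (h u hu) hp'

theorem enorm_lowerExt_le (α : ℝ) (u : Plane → Plane) (x : Plane) :
    ‖lowerExt α u x‖ₑ ≤ ENNReal.ofReal (10 + 10 * |α|) *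
      (‖u (reflection α (1 / 2) x)‖ₑ + ‖u (reflection α (3 / 2) x)‖ₑ) := by
  have h : ‖lowerExt α u x‖ ≤ (10 + 10 * |α|) *
      (‖u (reflection α (1 / 2) x)‖ + ‖u (reflection α (3 / 2) x)‖) := by
    refine (norm_le_abs_add_abs _).trans ?_
    rw [lowerExt_apply_zero, lowerExt_apply_one]
    have a0 := abs_apply_le_norm (u (reflection α (1 / 2) x)) 0
    have a1 := abs_apply_le_norm (u (reflection α (1 / 2) x)) 1
    have b0 := abs_apply_le_norm (u (reflection α (3 / 2) x)) 0
    have b1 := abs_apply_le_norm (u (reflection α (3 / 2) x)) 1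
    generalize u (reflection α (1 / 2) x) = a at *
    generalize u (reflection α (3 / 2) x) = b at *
    have ha := norm_nonneg a
    have hb := norm_nonneg b
    have hc : |α * (a 1 - b 1)| ≤ |α| * (‖a‖ + ‖b‖) := by
      rw [abs_mul]
      gcongr
      exact (abs_sub _ _).trans (add_le_add a1 b1)
    have hn : 0 ≤ |α| * (‖a‖ + ‖b‖) := by positivity
    rw [abs_le] at a0 a1 b0 b1 hc
    have c0 : |5 / 2 * a 0 - 3 / 2 * b 0 + 15 / 4 * α * (a 1 - b 1)| ≤
        5 * (‖a‖ + ‖b‖) + 5 * (|α| * (‖a‖ + ‖b‖)) := abs_le.2 ⟨by linarith, by linarith⟩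
    have c1 : |-(5 / 4) * a 1 + 9 / 4 * b 1| ≤ 5 * (‖a‖ + ‖b‖) :=
      abs_le.2 ⟨by linarith, by linarith⟩
    linarith
  rw [← ofReal_norm, ← ofReal_norm, ← ofReal_norm,
    ← ENNReal.ofReal_add (norm_nonneg _) (norm_nonneg _), ← ENNReal.ofReal_mul (by positivity)]
  exact ENNReal.ofReal_le_ofReal h

theorem exists_lintegral_enorm_reflection_le {p : ℝ} (α : ℝ) {η : ℝ} (hη : 0 < η) :
    ∃ C : ℝ≥0∞, C ≠ ∞ ∧ ∀ u : Plane → Plane,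
      ∫⁻ x in angleLower α, ‖u (reflection α η x)‖ₑ ^ p ≤ C * ∫⁻ x in angle α, ‖u x‖ₑ ^ p := by
  obtain ⟨C, hC, h⟩ := exists_setLIntegral_comp_affine_le (reflectionEquiv α η hη.ne')
  refine ⟨C, hC, fun u => ?_⟩
  have e := h (fun x => ‖u x‖ₑ ^ p) 0 _ _ (measurableSet_angleLower α) (measurableSet_angle α)
    (fun x hx => by rw [add_zero]; exact reflection_mem_angle hη hx)
  simp only [add_zero] at e
  exact e

theorem exists_eLpNorm_angleExt_le {p : ℝ} (α : ℝ) (hp : 1 < p) :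
    ∃ C : ℝ≥0∞, C ≠ ∞ ∧ ∀ u : Plane → Plane, Measurable u →
      eLpNorm (angleExt α u) (ENNReal.ofReal p) (volume.restrict halfPlane) ≤
        C * eLpNorm u (ENNReal.ofReal p) (volume.restrict (angle α)) := by
  have hp0 : 0 < p := by linarith
  obtain ⟨C₁, hC₁, h₁⟩ := exists_lintegral_enorm_reflection_le (p := p) α
    (by norm_num : (0 : ℝ) < 1 / 2)
  obtain ⟨C₂, hC₂, h₂⟩ := exists_lintegral_enorm_reflection_le (p := p) α
    (by norm_num : (0 : ℝ) < 3 / 2)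
  let K : ℝ≥0∞ := ENNReal.ofReal (10 + 10 * |α|) ^ p * 2 ^ (p - 1)
  have hK : K ≠ ∞ := ENNReal.mul_ne_top (ENNReal.rpow_ne_top_of_nonneg hp0.le ENNReal.ofReal_ne_top)
    (ENNReal.rpow_ne_top_of_nonneg (by linarith) (by simp))
  have hp' : 0 ≤ 1 / p := by positivity
  refine ⟨(1 + K * (C₁ + C₂)) ^ (1 / p), ENNReal.rpow_ne_top_of_nonneg hp'
    (by simp [*, ENNReal.mul_eq_top]), fun u hu => ?_⟩
  rw [eLpNorm_eq_lintegral_rpow_enorm_toReal (by simpa using hp0) ENNReal.ofReal_ne_top,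
    eLpNorm_eq_lintegral_rpow_enorm_toReal (by simpa using hp0) ENNReal.ofReal_ne_top,
    ENNReal.toReal_ofReal hp0.le, ← ENNReal.mul_rpow_of_nonneg _ _ hp']
  refine ENNReal.rpow_le_rpow ?_ hp'
  have hm : Measurable fun x => ‖u (reflection α (1 / 2) x)‖ₑ ^ p :=
    (hu.comp (measurable_reflection α _)).enorm.pow_const p
  have hD : ∫⁻ x in angle α, ‖angleExt α u x‖ₑ ^ p = ∫⁻ x in angle α, ‖u x‖ₑ ^ p :=
    setLIntegral_congr_fun (measurableSet_angle α) fun x hx => by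
      simp only [angleExt_of_mem hx]
  have hL : ∫⁻ x in angleLower α, ‖angleExt α u x‖ₑ ^ p ≤
      K * ((∫⁻ x in angleLower α, ‖u (reflection α (1 / 2) x)‖ₑ ^ p) +
        ∫⁻ x in angleLower α, ‖u (reflection α (3 / 2) x)‖ₑ ^ p) := by
    rw [← lintegral_add_left hm, ← lintegral_const_mul' _ _ hK]
    refine setLIntegral_mono' (measurableSet_angleLower α) fun x hx => ?_
    rw [angleExt_of_mem_angleLower hx]
    refine (ENNReal.rpow_le_rpow (enorm_lowerExt_le α u x) hp0.le).trans ?_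
    rw [ENNReal.mul_rpow_of_nonneg _ _ hp0.le, mul_assoc]
    exact mul_le_mul_right (ENNReal.rpow_add_le_mul_rpow_add_rpow _ _ hp.le) _
  calc _ ≤ ∫⁻ x, ‖angleExt α u x‖ₑ ^ p
          ∂(volume.restrict (angle α) + volume.restrict (angleLower α)) :=
        lintegral_mono' (restrict_halfPlane_le α) le_rfl
    _ ≤ (∫⁻ x in angle α, ‖u x‖ₑ ^ p) + K * ((C₁ * ∫⁻ x in angle α, ‖u x‖ₑ ^ p) +
          C₂ * ∫⁻ x in angle α, ‖u x‖ₑ ^ p) := by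
        rw [lintegral_add_measure, hD]
        exact add_le_add le_rfl (hL.trans (mul_le_mul_right (add_le_add (h₁ u) (h₂ u)) K))
    _ = _ := by ring

/-! ### Approximation of Lipschitz fields by C¹ fields. -/

/-- In polar coordinates the radial integrand is y^(1+a-b) near zero and y^(1-b) at infinity. -/
theorem lintegral_min_norm_one_rpow_lt_top {a b : ℝ} (hb : 2 < b) (hab : b < a + 2) :
    ∫⁻ z : Plane, ENNReal.ofReal (min ‖z‖ 1 ^ a / ‖z‖ ^ b) < ∞ := by
  have hint : Integrable (fun z : Plane => (fun y : ℝ => min y 1 ^ a / y ^ b) ‖z‖) := by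
    rw [integrable_fun_norm_addHaar volume (f := fun y : ℝ => min y 1 ^ a / y ^ b)]
    have hd : Module.finrank ℝ Plane - 1 = 1 := by simp
    rw [hd, ← Set.Ioc_union_Ioi_eq_Ioi zero_le_one]
    refine IntegrableOn.union ?_ ?_
    · rw [integrableOn_Ioc_iff_integrableOn_Ioo]
      refine ((intervalIntegral.integrableOn_Ioo_rpow_iff (s := 1 + a - b) one_pos).2
        (by linarith)).congr_fun (fun y hy => ?_) measurableSet_Ioo
      have h0 : 0 < y := hy.1
      simp only [smul_eq_mul, pow_one]
      rw [min_eq_left hy.2.le, Real.rpow_sub h0, Real.rpow_add h0, Real.rpow_one, mul_div_assoc]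
    · refine (integrableOn_Ioi_rpow_of_lt (a := 1 - b) (by linarith) one_pos).congr_fun
        (fun y hy => ?_) measurableSet_Ioi
      have h0 : 0 < y := one_pos.trans hy
      simp only [smul_eq_mul, pow_one]
      rw [min_eq_right (le_of_lt hy), Real.rpow_sub h0, Real.one_rpow, Real.rpow_one, mul_one_div]
  have h := hint.hasFiniteIntegral
  rw [hasFiniteIntegral_iff_norm] at h
  refine lt_of_le_of_lt (lintegral_mono fun z => ?_) h
  exact ENNReal.ofReal_le_ofReal (Real.le_norm_self _)

theorem abs_projDiff_le (u : Plane → Plane) (x y : Plane) : |projDiff u x y| ≤ ‖u y - u x‖ := by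
  refine (abs_real_inner_le_norm _ _).trans ?_
  refine mul_le_of_le_one_right (norm_nonneg _) ?_
  rw [norm_smul, norm_inv, norm_norm]
  exact inv_mul_le_one

/-- Energy of a Lipschitz field which is small and supported in a ball. -/
theorem exists_energy_le_of_small {s p : ℝ} (hs0 : 0 < s) (hs1 : s < 1) (hp : 1 < p)
    (K R : ℝ) :
    ∃ C : ℝ≥0∞, C ≠ ∞ ∧ ∀ (h : Plane → Plane) (r : ℝ), 0 < r → r ≤ 1 →
      (∀ x y, ‖h y - h x‖ ≤ K * ‖y - x‖) → (∀ x y, ‖h y - h x‖ ≤ K * r) →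
      (∀ x, x ∉ Metric.closedBall 0 R → h x = 0) → ∀ Ω : Set Plane,
      energy s p Ω h ≤ C * ENNReal.ofReal (r ^ (p * (1 - s) / 2)) := by
  have hp0 : 0 < p := by linarith
  -- Half of the gap p - ps. Since min(ρ, r)^p ≤ r^a min(ρ, 1)^(p-a), one half provides smallness in
  -- r, and the other keeps p - a > ps, so that `J` is integrable at the origin.
  set a := p * (1 - s) / 2 with ha_def
  have hps : 0 < p * s := by positivity
  have ha : 0 < a := by
    have : 0 < 1 - s := by linarith
    positivity
  have hpa : 0 < p - a := by
    have : p * (1 - s) < p * 1 := by gcongr; linarith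
    linarith
  let J : Plane → ℝ≥0∞ := fun z => ENNReal.ofReal (min ‖z‖ 1 ^ (p - a) / ‖z‖ ^ (2 + p * s))
  have hJ : ∫⁻ z, J z < ∞ := by
    refine lintegral_min_norm_one_rpow_lt_top (by linarith) ?_
    have : p * (1 - s) = p - p * s := by ring
    have : p * s < p * 1 := by gcongr
    linarith
  have hJm : Measurable J := by fun_prop
  let B : Set Plane := Metric.closedBall 0 R
  have hBm : MeasurableSet B := measurableSet_closedBall
  let V : ℝ≥0∞ := volume B
  have hV : V ≠ ∞ := measure_closedBall_lt_top.ne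
  refine ⟨ENNReal.ofReal (K ^ p) * (V * (∫⁻ z, J z) + V * ∫⁻ z, J z), ?_, ?_⟩
  · exact ENNReal.mul_ne_top ENNReal.ofReal_ne_top
      (ENNReal.add_ne_top.2 ⟨ENNReal.mul_ne_top hV hJ.ne, ENNReal.mul_ne_top hV hJ.ne⟩)
  intro h r hr0 hr1 hlip hsmall hsupp Ω
  let c : ℝ≥0∞ := ENNReal.ofReal (K ^ p) * ENNReal.ofReal (r ^ a)
  have hc : c ≠ ∞ := ENNReal.mul_ne_top ENNReal.ofReal_ne_top ENNReal.ofReal_ne_top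
  have hpt (x y : Plane) :
      ENNReal.ofReal (|projDiff h x y| ^ p / ‖y - x‖ ^ (((2 : ℕ) : ℝ) + p * s)) ≤
        c * (B.indicator 1 x * J (y - x) + B.indicator 1 y * J (y - x)) := by
    by_cases hxy : x = y
    · subst hxy
      simp [projDiff, Real.zero_rpow hp0.ne']
    have hne : ∀ h0 : projDiff h x y = 0, ENNReal.ofReal
        (|projDiff h x y| ^ p / ‖y - x‖ ^ (((2 : ℕ) : ℝ) + p * s)) = 0 := fun h0 => by
      simp [h0, Real.zero_rpow hp0.ne']
    have hρ : 0 < ‖y - x‖ := norm_pos_iff.2 (sub_ne_zero.2 (Ne.symm hxy))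
    -- If both points lie outside the ball, `h` vanishes at both. Otherwise one indicator equals 1,
    -- and it confines one variable to a set of finite volume.
    by_cases hB : x ∈ B ∨ y ∈ B
    · have hK : 0 ≤ K := by
        by_contra hK
        have := (norm_nonneg _).trans (hlip x y)
        nlinarith
      have h1 : |projDiff h x y| ^ p ≤ K ^ p * (r ^ a * min ‖y - x‖ 1 ^ (p - a)) := by
        have h2 : |projDiff h x y| ≤ K * min ‖y - x‖ r := by
          rw [mul_min_of_nonneg _ _ hK]
          exact (abs_projDiff_le h x y).trans (le_min (hlip x y) (hsmall x y))
        have h3 : 0 < min ‖y - x‖ r := lt_min hρ hr0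
        refine (Real.rpow_le_rpow (abs_nonneg _) h2 hp0.le).trans ?_
        rw [Real.mul_rpow hK h3.le]
        have h4 : min ‖y - x‖ r ^ p = min ‖y - x‖ r ^ a * min ‖y - x‖ r ^ (p - a) := by
          rw [← Real.rpow_add h3]; ring_nf
        rw [h4]
        gcongr
        exact min_le_right _ _
      have h5 : (1 : ℝ≥0∞) ≤ B.indicator 1 x + B.indicator 1 y := by
        rcases hB with hB | hB
        · rw [Set.indicator_of_mem hB]; exact le_self_add
        · rw [Set.indicator_of_mem hB]; exact le_add_self
      rw [← add_mul]
      calc _ ≤ c * J (y - x) := by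
            simp only [c, J]
            have hp1 : 0 ≤ min ‖y - x‖ 1 := le_min hρ.le zero_le_one
            rw [← ENNReal.ofReal_mul' (by positivity), ← ENNReal.ofReal_mul' (by positivity)]
            refine ENNReal.ofReal_le_ofReal ?_
            push_cast
            rw [mul_div_assoc']
            gcongr
            rw [mul_assoc]
            exact h1
        _ ≤ c * ((B.indicator 1 x + B.indicator 1 y) * J (y - x)) := by
            gcongr
            exact le_mul_of_one_le_left zero_le h5
    · rw [not_or] at hB
      rw [hne (by simp [projDiff, hsupp x hB.1, hsupp y hB.2])]
      exact zero_le
  have hind : Measurable (B.indicator (1 : Plane → ℝ≥0∞)) := measurable_one.indicator hBm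
  have hVeq : ∫⁻ x, B.indicator (1 : Plane → ℝ≥0∞) x = V := lintegral_indicator_one hBm
  have hm1 : Measurable fun z : Plane × Plane => B.indicator (1 : Plane → ℝ≥0∞) z.1 * J (z.2 - z.1) :=
    (hind.comp measurable_fst).mul (hJm.comp (measurable_snd.sub measurable_fst))
  have hm2 : Measurable fun z : Plane × Plane => B.indicator (1 : Plane → ℝ≥0∞) z.2 * J (z.2 - z.1) :=
    (hind.comp measurable_snd).mul (hJm.comp (measurable_snd.sub measurable_fst))
  have hi1 : ∫⁻ x, ∫⁻ y, B.indicator (1 : Plane → ℝ≥0∞) x * J (y - x) = V * ∫⁻ z, J z := by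
    have h1 (x : Plane) : ∫⁻ y, B.indicator (1 : Plane → ℝ≥0∞) x * J (y - x) =
        B.indicator (1 : Plane → ℝ≥0∞) x * ∫⁻ z, J z := by
      rw [lintegral_const_mul _ (by fun_prop), lintegral_sub_right_eq_self]
    simp only [h1]
    rw [lintegral_mul_const _ hind, hVeq]
  have hi2 : ∫⁻ x, ∫⁻ y, B.indicator (1 : Plane → ℝ≥0∞) y * J (y - x) = V * ∫⁻ z, J z := by
    rw [lintegral_lintegral_swap hm2.aemeasurable]
    have h1 (y : Plane) : ∫⁻ x, B.indicator (1 : Plane → ℝ≥0∞) y * J (y - x) =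
        B.indicator (1 : Plane → ℝ≥0∞) y * ∫⁻ z, J z := by
      rw [lintegral_const_mul _ (by fun_prop), lintegral_sub_left_eq_self]
    simp only [h1]
    rw [lintegral_mul_const _ hind, hVeq]
  calc energy s p Ω h ≤ ∫⁻ x, ∫⁻ y,
        c * (B.indicator 1 x * J (y - x) + B.indicator 1 y * J (y - x)) :=
        lintegral_mono' Measure.restrict_le_self fun x =>
          lintegral_mono' Measure.restrict_le_self fun y => hpt x y
    _ = c * ∫⁻ x, ∫⁻ y, (B.indicator 1 x * J (y - x) + B.indicator 1 y * J (y - x)) := by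
        simp only [lintegral_const_mul' _ _ hc]
    _ = c * (V * (∫⁻ z, J z) + V * ∫⁻ z, J z) := by
        congr 1
        have h1 (x : Plane) : ∫⁻ y, (B.indicator (1 : Plane → ℝ≥0∞) x * J (y - x) +
            B.indicator (1 : Plane → ℝ≥0∞) y * J (y - x)) =
            (∫⁻ y, B.indicator (1 : Plane → ℝ≥0∞) x * J (y - x)) +
              ∫⁻ y, B.indicator (1 : Plane → ℝ≥0∞) y * J (y - x) :=
          lintegral_add_left (hm1.comp measurable_prodMk_left) _
        simp only [h1]
        rw [lintegral_add_left hm1.lintegral_prod_right', hi1, hi2]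
    _ = _ := by ring

/-- Mollification of a compactly supported Lipschitz field. -/
theorem exists_isC1c_dist_le {g : Plane → Plane} {K : NNReal} {R : ℝ} (hg : LipschitzWith K g)
    (hsupp : ∀ x, x ∉ Metric.closedBall 0 R → g x = 0) {r : ℝ} (hr0 : 0 < r) (hr1 : r ≤ 1) :
    ∃ ψ : Plane → Plane, IsC1c ψ ∧ LipschitzWith K ψ ∧ (∀ x, ‖g x - ψ x‖ ≤ K * r) ∧
      ∀ x, x ∉ Metric.closedBall 0 (R + 1) → g x - ψ x = 0 := by
  -- With outer radius r ≤ 1, averaging changes a K-Lipschitz field by at most K r and enlarges the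
  -- support by at most 1.
  let φ : ContDiffBump (0 : Plane) := ⟨r / 2, r, by positivity, by linarith⟩
  have hgc := hg.continuous
  let ψ : Plane → Plane :=
    convolution (φ.normed volume) g (ContinuousLinearMap.lsmul ℝ ℝ) volume
  have hex (x : Plane) : Integrable fun t => φ.normed volume t • g (x - t) :=
    φ.hasCompactSupport_normed.convolutionExists_left (ContinuousLinearMap.lsmul ℝ ℝ)
      φ.continuous_normed hgc.locallyIntegrable x
  have hψ (x : Plane) : ψ x = ∫ t, φ.normed volume t • g (x - t) := rfl
  have heq : ∀ x, x ∉ Metric.closedBall 0 (R + 1) → g x - ψ x = 0 := by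
    intro x hx
    have hx' : R + 1 < ‖x‖ := by simpa using hx
    have hgx (y : Plane) (hy : y ∈ Metric.ball x r) : g y = 0 := by
      refine hsupp y ?_
      rw [mem_ball_iff_norm] at hy
      have : ‖x‖ ≤ ‖y‖ + ‖y - x‖ := by
        rw [norm_sub_rev]
        simpa using norm_add_le y (x - y)
      rw [mem_closedBall_zero_iff]
      linarith
    have h1 : ψ x = g x := ContDiffBump.normed_convolution_eq_right fun y hy => by
      rw [hgx y hy, hgx x (Metric.mem_ball_self hr0)]
    rw [h1, sub_self]
  refine ⟨ψ, ⟨?_, ?_⟩, ?_, ?_, heq⟩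
  · exact φ.hasCompactSupport_normed.contDiff_convolution_left (n := 1) _ φ.contDiff_normed
      hgc.locallyIntegrable
  · refine HasCompactSupport.intro (isCompact_closedBall (0 : Plane) (R + 1)) fun x hx => ?_
    have h1 := heq x hx
    rw [hsupp x (fun h => hx (Metric.closedBall_subset_closedBall (by linarith) h))] at h1
    simpa using h1
  · refine LipschitzWith.of_dist_le_mul fun x y => ?_
    rw [dist_eq_norm, hψ, hψ, ← integral_sub (hex x) (hex y)]
    have hint : Integrable fun t => φ.normed volume t * (K * dist x y) :=
      φ.integrable_normed.mul_const _
    refine (norm_integral_le_of_norm_le hint (Eventually.of_forall fun t => ?_)).trans ?_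
    · rw [← smul_sub, norm_smul, Real.norm_of_nonneg (φ.nonneg_normed t), ← dist_eq_norm]
      refine mul_le_mul_of_nonneg_left ?_ (φ.nonneg_normed t)
      simpa using hg.dist_le_mul (x - t) (y - t)
    · rw [integral_mul_const, φ.integral_normed, one_mul]
  · intro x
    rw [← dist_eq_norm, dist_comm]
    refine ContDiffBump.dist_normed_convolution_le hgc.aestronglyMeasurable fun y hy => ?_
    refine (hg.dist_le_mul y x).trans ?_
    have : dist y x ≤ r := (Metric.mem_ball.1 hy).le
    gcongr

/-- Compactly supported Lipschitz fields are limits of `C¹` fields. -/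
theorem exists_isC1c_normX_sub_le {s p : ℝ} (hs0 : 0 < s) (hs1 : s < 1) (hp : 1 < p)
    {g : Plane → Plane} {K : NNReal} (hg : LipschitzWith K g) (hgs : HasCompactSupport g)
    (Ω : Set Plane) {ε : ℝ≥0∞} (hε : ε ≠ 0) :
    ∃ ψ : Plane → Plane, IsC1c ψ ∧ normX s p Ω (g - ψ) ≤ ε := by
  have hp0 : 0 < p := by linarith
  obtain ⟨R, hR⟩ := hgs.isCompact.isBounded.subset_closedBall (0 : Plane)
  have hsupp : ∀ x, x ∉ Metric.closedBall 0 R → g x = 0 := fun x hx =>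
    image_eq_zero_of_notMem_tsupport fun h => hx (hR h)
  -- Both `g` and its mollification are K-Lipschitz and differ by at most K r, so increments of the
  -- difference satisfy both bounds with 2K.
  obtain ⟨C, hC, hen⟩ := exists_energy_le_of_small hs0 hs1 hp (2 * K) (R + 1)
  let V : ℝ≥0∞ := volume (Metric.closedBall (0 : Plane) (R + 1)) ^ (1 / p)
  have hV : V ≠ ∞ := ENNReal.rpow_ne_top_of_nonneg (by positivity) measure_closedBall_lt_top.ne
  let bound : ℝ → ℝ≥0∞ := fun r =>
    ENNReal.ofReal (K * r) * V + (C * ENNReal.ofReal (r ^ (p * (1 - s) / 2))) ^ (1 / p)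
  have ha : 0 < p * (1 - s) / 2 := by
    have : 0 < 1 - s := by linarith
    positivity
  have hlim : Tendsto bound (𝓝 0) (𝓝 0) := by
    have h1 : Tendsto (fun r : ℝ => ENNReal.ofReal (K * r) * V) (𝓝 0) (𝓝 0) := by
      have h := ENNReal.Tendsto.mul_const (b := V)
        (ENNReal.tendsto_ofReal ((continuous_const_mul (K : ℝ)).tendsto 0)) (Or.inr hV)
      simpa using h
    have h2 : Tendsto (fun r : ℝ => (C * ENNReal.ofReal (r ^ (p * (1 - s) / 2))) ^ (1 / p))
        (𝓝 0) (𝓝 0) := by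
      have h := ENNReal.tendsto_ofReal ((Real.continuous_rpow_const ha.le).tendsto 0)
      rw [Real.zero_rpow ha.ne', ENNReal.ofReal_zero] at h
      have h' := ENNReal.Tendsto.const_mul (a := C) h (Or.inr hC)
      rw [mul_zero] at h'
      have h'' := ((ENNReal.continuous_rpow_const (y := 1 / p)).tendsto 0).comp h'
      rwa [ENNReal.zero_rpow_of_pos (by positivity)] at h''
    have h := h1.add h2
    rwa [add_zero] at h
  have hev : ∀ᶠ r in 𝓝[>] (0 : ℝ), bound r ≤ ε ∧ 0 < r ∧ r ≤ 1 := by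
    filter_upwards [(hlim.mono_left nhdsWithin_le_nhds).eventually_le_const
      (pos_iff_ne_zero.2 hε), Ioc_mem_nhdsGT (zero_lt_one (α := ℝ))] with r h1 h2
    exact ⟨h1, h2.1, h2.2⟩
  obtain ⟨r, hrε, hr0, hr1⟩ := hev.exists
  obtain ⟨ψ, hψ, hψL, hψd, hψs⟩ := exists_isC1c_dist_le hg hsupp hr0 hr1
  refine ⟨ψ, hψ, le_trans ?_ hrε⟩
  refine add_le_add ?_ ?_
  · have hmono : eLpNorm (g - ψ) (ENNReal.ofReal p) (volume.restrict Ω) ≤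
        eLpNorm ((Metric.closedBall (0 : Plane) (R + 1)).indicator fun _ => (K * r : ℝ))
          (ENNReal.ofReal p) volume := by
      refine (eLpNorm_mono_measure _ Measure.restrict_le_self).trans (eLpNorm_mono fun x => ?_)
      by_cases hx : x ∈ Metric.closedBall (0 : Plane) (R + 1)
      · rw [Set.indicator_of_mem hx]
        exact (hψd x).trans (Real.le_norm_self _)
      · rw [Set.indicator_of_notMem hx, Pi.sub_apply, hψs x hx, norm_zero, norm_zero]
    refine hmono.trans ((eLpNorm_indicator_const_le _ _).trans (le_of_eq ?_))
    rw [ENNReal.toReal_ofReal hp0.le, Real.enorm_eq_ofReal (by positivity)]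
  · refine ENNReal.rpow_le_rpow ?_ (by positivity)
    refine hen (g - ψ) r hr0 hr1 (fun x y => ?_) (fun x y => ?_) hψs Ω
    · have h1 := hg.dist_le_mul y x
      have h2 := hψL.dist_le_mul y x
      rw [dist_eq_norm, dist_eq_norm] at h1 h2
      have e : (g - ψ) y - (g - ψ) x = (g y - g x) - (ψ y - ψ x) := by
        simp only [Pi.sub_apply]; abel
      rw [e]
      refine (norm_sub_le _ _).trans ?_
      linarith
    · simp only [Pi.sub_apply]
      refine (norm_sub_le _ _).trans ?_
      linarith [hψd x, hψd y]

/-! ### Extensions of C¹ fields are Lipschitz. -/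

theorem isC1c_lowerExt (α : ℝ) {φ : Plane → Plane} (hφ : IsC1c φ) : IsC1c (lowerExt α φ) := by
  obtain ⟨hd, hc⟩ := hφ
  have hr (η : ℝ) : ContDiff ℝ 1 (reflection α η) := by
    rw [contDiff_euclidean]
    intro i
    fin_cases i
    · simp only [Fin.zero_eta, reflection_apply_zero]
      fun_prop
    · simp only [Fin.mk_one, reflection_apply_one]
      fun_prop
  have hcomp (η : ℝ) (i : Fin 2) : ContDiff ℝ 1 fun x => φ (reflection α η x) i :=
    contDiff_euclidean.1 (hd.comp (hr η)) i
  constructor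
  · rw [contDiff_euclidean]
    intro i
    fin_cases i
    · simp only [Fin.zero_eta, lowerExt_apply_zero]
      exact ((contDiff_const.mul (hcomp _ 0)).sub (contDiff_const.mul (hcomp _ 0))).add
        (contDiff_const.mul ((hcomp _ 1).sub (hcomp _ 1)))
    · simp only [Fin.mk_one, lowerExt_apply_one]
      exact (contDiff_const.mul (hcomp _ 1)).add (contDiff_const.mul (hcomp _ 1))
  · have hcompact {η : ℝ} (hη : η ≠ 0) : IsCompact (reflection α η ⁻¹' tsupport φ) :=
      (reflectionEquiv α η hη).toContinuousLinearEquiv.toHomeomorph.isCompact_preimage.2 hc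
    refine HasCompactSupport.intro ((hcompact (η := 1 / 2) (by norm_num)).union
      (hcompact (η := 3 / 2) (by norm_num))) fun x hx => ?_
    rw [Set.mem_union, not_or] at hx
    have h1 : φ (reflection α (1 / 2) x) = 0 := image_eq_zero_of_notMem_tsupport hx.1
    have h2 : φ (reflection α (3 / 2) x) = 0 := image_eq_zero_of_notMem_tsupport hx.2
    rw [lowerExt_apply, h1, h2]
    ext i
    fin_cases i <;> simp

/-- Reflections fix the line, k + ℓ = m + q = 1, and the mixed term cancels: the extension is
continuous across the interface. -/
theorem lowerExt_eq_of_mem_line {α : ℝ} (u : Plane → Plane) {x : Plane} (hx : α * x 0 = x 1) :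
    lowerExt α u x = u x := by
  have h (η : ℝ) : reflection α η x = x := by
    ext i
    fin_cases i <;> simp [reflection, hx]
  ext i
  fin_cases i <;> simp [lowerExt_apply, h] <;> ring

open Classical in
/-- Two Lipschitz fields which agree on a line can be glued along it. -/
theorem lipschitzWith_ite_line {α : ℝ} {f g : Plane → Plane} {K L : NNReal} (hf : LipschitzWith K f)
    (hg : LipschitzWith L g) (hfg : ∀ x : Plane, α * x 0 = x 1 → f x = g x) :
    LipschitzWith (K + L) fun x : Plane => if α * x 0 < x 1 then f x else g x := by
  have key (x y : Plane) (hx : α * x 0 < x 1) (hy : y 1 ≤ α * y 0) :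
      dist (f x) (g y) ≤ (K + L) * dist x y := by
    set a := x 1 - α * x 0 with ha
    set b := α * y 0 - y 1 with hb
    have ha0 : 0 < a := sub_pos.2 hx
    have hb0 : 0 ≤ b := sub_nonneg.2 hy
    have hab : 0 < a + b := by linarith
    -- The point where the segment from `x` to `y` crosses the line; there `f` and `g` agree, and
    -- the two pieces have total length |x - y|.
    let z : Plane := (b / (a + b)) • x + (a / (a + b)) • y
    have hzs : z ∈ segment ℝ x y :=
      ⟨b / (a + b), a / (a + b), by positivity, by positivity, by field_simp; ring, rfl⟩
    have hz : α * z 0 = z 1 := by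
      simp only [z, PiLp.add_apply, PiLp.smul_apply, smul_eq_mul]
      have e : b * a = a * b := mul_comm _ _
      rw [ha, hb] at e
      field_simp
      rw [ha, hb]
      ring
    have hd := dist_add_dist_of_mem_segment hzs
    have h1 := hf.dist_le_mul x z
    have h2 := hg.dist_le_mul z y
    rw [← hfg z hz] at h2
    have h3 := dist_triangle (f x) (f z) (g y)
    have h4 : (K : ℝ) * dist x z ≤ K * dist x y := by
      gcongr
      linarith [dist_nonneg (x := z) (y := y)]
    have h5 : (L : ℝ) * dist z y ≤ L * dist x y := by
      gcongr
      linarith [dist_nonneg (x := x) (y := z)]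
    linarith
  refine LipschitzWith.of_dist_le_mul fun x y => ?_
  have hKd : 0 ≤ (K : ℝ) * dist x y := by positivity
  have hLd : 0 ≤ (L : ℝ) * dist x y := by positivity
  push_cast
  by_cases hx : α * x 0 < x 1 <;> by_cases hy : α * y 0 < y 1
  · simp only [if_pos hx, if_pos hy]
    linarith [hf.dist_le_mul x y]
  · simp only [if_pos hx, if_neg hy]
    exact key x y hx (not_lt.1 hy)
  · simp only [if_neg hx, if_pos hy]
    rw [dist_comm, dist_comm x y]
    exact key y x hy (not_lt.1 hx)
  · simp only [if_neg hx, if_neg hy]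
    linarith [hg.dist_le_mul x y]

/-- The extension of a `C¹` field coincides on the half plane with a compactly supported
Lipschitz field. -/
theorem exists_lipschitzWith_eqOn_angleExt (α : ℝ) {φ : Plane → Plane} (hφ : IsC1c φ) :
    ∃ (g : Plane → Plane) (K : NNReal), LipschitzWith K g ∧ HasCompactSupport g ∧
      ∀ x ∈ halfPlane, angleExt α φ x = g x := by
  classical
  have hl := isC1c_lowerExt α hφ
  obtain ⟨K, hK⟩ := ContDiff.lipschitzWith_of_hasCompactSupport hφ.2 hφ.1 one_ne_zero
  obtain ⟨L, hL⟩ := ContDiff.lipschitzWith_of_hasCompactSupport hl.2 hl.1 one_ne_zero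
  refine ⟨_, _, lipschitzWith_ite_line (α := α) hK hL
    fun x hx => (lowerExt_eq_of_mem_line φ hx).symm, ?_, fun x hx => ?_⟩
  · refine HasCompactSupport.intro (hφ.2.isCompact.union hl.2.isCompact) fun x hx => ?_
    rw [Set.mem_union, not_or] at hx
    rw [image_eq_zero_of_notMem_tsupport hx.1, image_eq_zero_of_notMem_tsupport hx.2, ite_self]
  · by_cases h : α * x 0 < x 1
    · rw [if_pos h, angleExt_of_mem ⟨hx, h⟩]
    · rw [if_neg h, angleExt, if_neg fun h' => h h'.2]

theorem exists_isC1c_normX_angleExt_sub_le {s p : ℝ} (α : ℝ) (hs0 : 0 < s) (hs1 : s < 1)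
    (hp : 1 < p) {φ : Plane → Plane} (hφ : IsC1c φ) {ε : ℝ≥0∞} (hε : ε ≠ 0) :
    ∃ ψ : Plane → Plane, IsC1c ψ ∧ normX s p halfPlane (angleExt α φ - ψ) ≤ ε := by
  obtain ⟨g, K, hg, hgs, heq⟩ := exists_lipschitzWith_eqOn_angleExt α hφ
  obtain ⟨ψ, hψ, hle⟩ := exists_isC1c_normX_sub_le hs0 hs1 hp hg hgs halfPlane hε
  refine ⟨ψ, hψ, le_trans (le_of_eq (normX_congr ?_)) hle⟩
  have hm : MeasurableSet halfPlane := by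
    have h0 : IsOpen {x : Plane | 0 < x 0} := isOpen_lt (by fun_prop) (by fun_prop)
    exact h0.measurableSet
  filter_upwards [ae_restrict_mem hm] with x hx
  rw [Pi.sub_apply, Pi.sub_apply, heq x hx]

/-! ### The operator on the spaces. -/

theorem exists_normX_angleExt_le {s p : ℝ} (α : ℝ) (hs : 0 < s) (hp : 1 < p) :
    ∃ C : ℝ≥0∞, C ≠ ∞ ∧ ∀ u : Plane → Plane, Measurable u →
      normX s p halfPlane (angleExt α u) ≤ C * normX s p (angle α) u := by
  obtain ⟨C₁, hC₁, h₁⟩ := exists_eLpNorm_angleExt_le (p := p) α hp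
  obtain ⟨C₂, hC₂, h₂⟩ := exists_seminormX_angleExt_le (s := s) (p := p) α hs hp
  refine ⟨C₁ + C₂, ENNReal.add_ne_top.2 ⟨hC₁, hC₂⟩, fun u hu => ?_⟩
  rw [normX, normX, mul_add]
  refine (add_le_add (h₁ u hu) (h₂ u hu)).trans ?_
  gcongr
  · exact le_self_add
  · exact le_add_self

theorem memLp_angleExt {p : ℝ} (α : ℝ) (hp : 1 < p)
    (u : Lp Plane (ENNReal.ofReal p) (volume.restrict (angle α))) :
    MemLp (angleExt α u) (ENNReal.ofReal p) (volume.restrict halfPlane) := by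
  obtain ⟨C, hC, h⟩ := exists_eLpNorm_angleExt_le (p := p) α hp
  -- The chosen representative is measurable on the whole plane, so composing it with reflections
  -- causes no difficulty.
  have hu := (Lp.stronglyMeasurable u).measurable
  exact ⟨(measurable_angleExt α hu).aestronglyMeasurable,
    (h u hu).trans_lt (ENNReal.mul_lt_top hC.lt_top (Lp.eLpNorm_lt_top u))⟩

/-- The formula evaluates representatives pointwise, so independence of the choice must be shown. By
linearity it follows from the Lebesgue bound applied to `u - v`, which has norm zero. -/
theorem angleExt_congr_ae {p : ℝ} (α : ℝ) (hp : 1 < p) {u v : Plane → Plane} (hu : Measurable u)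
    (hv : Measurable v) (h : u =ᵐ[volume.restrict (angle α)] v) :
    angleExt α u =ᵐ[volume.restrict halfPlane] angleExt α v := by
  obtain ⟨C, hC, hle⟩ := exists_eLpNorm_angleExt_le (p := p) α hp
  have hp0 : ENNReal.ofReal p ≠ 0 := by
    have : 0 < p := by linarith
    simpa using this
  have h0 : eLpNorm (u - v) (ENNReal.ofReal p) (volume.restrict (angle α)) = 0 := by
    rw [eLpNorm_eq_zero_iff (hu.sub hv).aestronglyMeasurable hp0]
    filter_upwards [h] with x hx
    simp [hx]
  have h1 := hle (u - v) (hu.sub hv)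
  rw [h0, mul_zero, nonpos_iff_eq_zero,
    eLpNorm_eq_zero_iff (measurable_angleExt α (hu.sub hv)).aestronglyMeasurable hp0,
    angleExt_sub] at h1
  filter_upwards [h1] with x hx
  simpa [sub_eq_zero] using hx

/-- The extension as a linear map between the Lebesgue spaces. -/
noncomputable def angleExtLp (p α : ℝ) (hp : 1 < p) :
    Lp Plane (ENNReal.ofReal p) (volume.restrict (angle α)) →ₗ[ℝ]
      Lp Plane (ENNReal.ofReal p) (volume.restrict halfPlane) where
  toFun u := (memLp_angleExt α hp u).toLp (angleExt α u)
  map_add' u v := by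
    refine Lp.ext ?_
    have hu := (Lp.stronglyMeasurable u).measurable
    have hv := (Lp.stronglyMeasurable v).measurable
    filter_upwards [(memLp_angleExt α hp (u + v)).coeFn_toLp, (memLp_angleExt α hp u).coeFn_toLp,
      (memLp_angleExt α hp v).coeFn_toLp, Lp.coeFn_add ((memLp_angleExt α hp u).toLp _)
        ((memLp_angleExt α hp v).toLp _), angleExt_congr_ae α hp
        (Lp.stronglyMeasurable (u + v)).measurable (hu.add hv) (Lp.coeFn_add u v)]
      with x h1 h2 h3 h4 h5
    rw [h1, h4, h5, angleExt_add, Pi.add_apply, Pi.add_apply, h2, h3]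
  map_smul' c u := by
    refine Lp.ext ?_
    have hu := (Lp.stronglyMeasurable u).measurable
    filter_upwards [(memLp_angleExt α hp (c • u)).coeFn_toLp, (memLp_angleExt α hp u).coeFn_toLp,
      Lp.coeFn_smul c ((memLp_angleExt α hp u).toLp _), angleExt_congr_ae α hp
        (Lp.stronglyMeasurable (c • u)).measurable (hu.const_smul c) (Lp.coeFn_smul c u)]
      with x h1 h2 h3 h4
    rw [h1, RingHom.id_apply, h3, h4, angleExt_smul, Pi.smul_apply, Pi.smul_apply, h2]

theorem coeFn_angleExtLp (p α : ℝ) (hp : 1 < p)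
    (u : Lp Plane (ENNReal.ofReal p) (volume.restrict (angle α))) :
    angleExtLp p α hp u =ᵐ[volume.restrict halfPlane] angleExt α u :=
  (memLp_angleExt α hp u).coeFn_toLp

theorem angleExtLp_mem_XSpace {s p : ℝ} (α : ℝ) (hs0 : 0 < s) (hs1 : s < 1) (hp : 1 < p)
    {u : Lp Plane (ENNReal.ofReal p) (volume.restrict (angle α))}
    (hu : u ∈ XSpace s p hp (angle α)) : angleExtLp p α hp u ∈ XSpace s p hp halfPlane := by
  obtain ⟨husem, φ, hφ, hlim⟩ := hu
  have hum := (Lp.stronglyMeasurable u).measurable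
  have hext := coeFn_angleExtLp p α hp u
  refine ⟨?_, ?_⟩
  · obtain ⟨C, hC, h⟩ := exists_seminormX_angleExt_le (s := s) (p := p) α hs0 hp
    rw [seminormX_congr hext]
    exact (h u hum).trans_lt (ENNReal.mul_lt_top hC.lt_top husem)
  · obtain ⟨C, hC, h⟩ := exists_normX_angleExt_le (s := s) (p := p) α hs0 hp
    -- The tolerance is 1/k; at k = 0 it is ∞, which is harmless.
    have hε (k : ℕ) : ((k : ℝ≥0∞))⁻¹ ≠ 0 := by simp
    choose ψ hψ hψle using fun k =>
      exists_isC1c_normX_angleExt_sub_le α hs0 hs1 hp (hφ k) (hε k)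
    have hb := (ENNReal.Tendsto.const_mul (a := C) hlim (Or.inr hC)).add
      ENNReal.tendsto_inv_nat_nhds_zero
    rw [mul_zero, add_zero] at hb
    refine ⟨ψ, hψ, tendsto_of_tendsto_of_tendsto_of_le_of_le tendsto_const_nhds hb
      (fun _ => zero_le) fun k => ?_⟩
    have hφm := (hφ k).1.continuous.measurable
    -- Split the error into the extension of `u - φ k`, small by boundedness, and the approximation
    -- error for the extension of `φ k`.
    have e1 : normX s p halfPlane (fun x => angleExtLp p α hp u x - ψ k x) =
        normX s p halfPlane (angleExt α (u - φ k) + (angleExt α (φ k) - ψ k)) := by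
      refine normX_congr ?_
      filter_upwards [hext] with x hx
      rw [hx, angleExt_sub]
      simp
    dsimp only
    rw [e1]
    refine (normX_add_le hp (measurable_angleExt α (hum.sub hφm)).aestronglyMeasurable
      ((measurable_angleExt α hφm).aestronglyMeasurable.sub (hψ k).aesm)).trans ?_
    exact add_le_add (h _ (hum.sub hφm)) (hψle k)

end FracKorn

theorem mainTheorem6 (s p α : ℝ) (hs0 : 0 < s) (hs1 : s < 1) (hp : 1 < p) :
    ∃ E : FracKorn.XSpace s p hp (FracKorn.angle α) →ₗ[ℝ]
        FracKorn.XSpace s p hp FracKorn.halfPlane,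
      -- `E` extends
      (∀ u, ∀ᵐ x ∂(volume.restrict (FracKorn.angle α)), (E u).1 x = u.1 x) ∧
      -- `E` is a modified Nitsche extension
      (∃ δ : ℝ, 0 < δ ∧ δ ≤ 1 / 2 ∧
        ∀ u, ∀ᵐ x ∂(volume.restrict (FracKorn.angleLower α)),
          (E u).1 x = FracKorn.nitsche α (1 - δ) (1 + δ) u.1 x) ∧
      ∃ C : ℝ, 0 < C ∧
        -- `E` is bounded
        (∀ u, FracKorn.normX s p FracKorn.halfPlane (E u).1 ≤
          ENNReal.ofReal C * FracKorn.normX s p (FracKorn.angle α) u.1) ∧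
        -- the seminorm estimate
        (∀ u, FracKorn.seminormX s p FracKorn.halfPlane (E u).1 ≤
          ENNReal.ofReal C * (FracKorn.seminormX s p (FracKorn.angle α) u.1 +
            eLpNorm u.1 (ENNReal.ofReal p) (volume.restrict (FracKorn.angle α)))) := by
  obtain ⟨C₁, hC₁, h₁⟩ := FracKorn.exists_normX_angleExt_le (s := s) (p := p) α hs0 hp
  obtain ⟨C₂, hC₂, h₂⟩ := FracKorn.exists_seminormX_angleExt_le (s := s) (p := p) α hs0 hp
  -- δ = 1/2 is the parameter built into `lowerExt`; the summand 1 in the constant only ensures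
  -- positivity.
  refine ⟨(FracKorn.angleExtLp p α hp).restrict
    fun u hu => FracKorn.angleExtLp_mem_XSpace α hs0 hs1 hp hu, fun u => ?_,
    ⟨1 / 2, by norm_num, le_rfl, fun u => ?_⟩, 1 + C₁.toReal + C₂.toReal, by positivity,
    fun u => ?_, fun u => ?_⟩
  · filter_upwards [ae_restrict_of_ae_restrict_of_subset (FracKorn.angle_subset_halfPlane α)
      (FracKorn.coeFn_angleExtLp p α hp u.1), ae_restrict_mem (FracKorn.measurableSet_angle α)]
      with x hx hxD
    exact hx.trans (FracKorn.angleExt_of_mem hxD)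
  · filter_upwards [ae_restrict_of_ae_restrict_of_subset (FracKorn.angleLower_subset_halfPlane α)
      (FracKorn.coeFn_angleExtLp p α hp u.1), ae_restrict_mem (FracKorn.measurableSet_angleLower α)]
      with x hx hxL
    exact hx.trans (FracKorn.angleExt_of_mem_angleLower hxL)
  · have hm := (Lp.stronglyMeasurable u.1).measurable
    have hC : C₁ ≤ ENNReal.ofReal (1 + C₁.toReal + C₂.toReal) := by
      rw [← ENNReal.ofReal_toReal hC₁]
      exact ENNReal.ofReal_le_ofReal (by
        rw [ENNReal.toReal_ofReal ENNReal.toReal_nonneg]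
        linarith [ENNReal.toReal_nonneg (a := C₂)])
    refine le_trans (le_of_eq (FracKorn.normX_congr (FracKorn.coeFn_angleExtLp p α hp u.1))) ?_
    exact (h₁ u.1 hm).trans (mul_le_mul_left hC _)
  · have hm := (Lp.stronglyMeasurable u.1).measurable
    have hC : C₂ ≤ ENNReal.ofReal (1 + C₁.toReal + C₂.toReal) := by
      rw [← ENNReal.ofReal_toReal hC₂]
      exact ENNReal.ofReal_le_ofReal (by
        rw [ENNReal.toReal_ofReal ENNReal.toReal_nonneg]
        linarith [ENNReal.toReal_nonneg (a := C₁)])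
    refine le_trans (le_of_eq (FracKorn.seminormX_congr (FracKorn.coeFn_angleExtLp p α hp u.1))) ?_
    -- The seminorm on D suffices on the right; the Lebesgue norm is simply added.
    exact (h₂ u.1 hm).trans (mul_le_mul' hC le_self_add)
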